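/- Let $\mathbb F$ be $\mathbb R$ or $\mathbb C$, let $V=\mathbb F^n$ with $n\ge 1$, let $k\ge 1$, let $d_1,\dots,d_k$ be positive integers and $\delta_1,\dots,\delta_k\in(0,1)$. Let $X\subseteq V$ be a conic variety (a Zariski closed set of $\mathbb F$-points, stable under scalars) with irreducible components $X_1,\dots,X_k$. Suppose that, for each $i$, no non-zero homogeneous polynomial of degree $d_i-1$ vanishes on $X_i$, and that $X_i$ is the common zero set of $p_i=\delta_i\binom{n+d_i-1}{d_i}$ given linearly independent homogeneous polynomials $f_{i,1},\dots,f_{i,p_i}$ of degree $d_i$. Let $R\ge 1$ be an integer with $$R\le \min_{1\le i\le k}\ \frac{\delta_i}{d_i!}\,(n+d_i-1).$$ *Algorithm 2.* The input is a basis $u_1,\dots,u_R$ of a subspace $U\subseteq V$ and the polynomials $f_{i,j}$. For each $i$, run Algorithm 1 on $u_1,\dots,u_R$ and $f_{i,1},\dots,f_{i,p_i}$. If some of these runs report non-zero vectors, output all of these vectors; otherwise, if all runs output "$U$ trivially intersects $X_i$", output "$U$ trivially intersects $X$"; otherwise output "Fail". *Algorithm 1* (basis $u_1,\dots,u_R$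 of $U$; forms $f_1,\dots,f_p$ of degree $d$ cutting out a variety $Y$). Compute a basis $P_1,\dots,P_s$ of $S^d(U)\cap I_d^\perp$, where $I_d=\operatorname{span}\{f_1,\dots,f_p\}\subseteq S^d(V^*)$ and $I_d^\perp$ is the set of tensors annihilated by $I_d$. If $s=0$, output "$U$ trivially intersects $Y$". If $s>R$, output "Fail". Otherwise run the simultaneous diagonalization algorithm on $T=\sum_{q=1}^s e_q\otimes P_q\in\mathbb F^s\otimes V\otimes V^{\otimes(d-1)}$. If it outputs a decomposition of $T$ of the form $\{c_q\otimes x_q^{\otimes d}: 1\le q\le s\}$ with linearly independent $c_1,\dots,c_s\in\mathbb F^s$ and linearly independent $x_1,\dots,x_s\in V$, output "the only elements of $U\cap Y$ are $x_1,\dots,x_s$ (up to scale)"; otherwise output "Fail". *Simultaneous diagonalization* ($T\in V_1\otimes V_2\otimes V_3$, all coordinate spaces). Draw $g,h\in V_1^*$ independently and uniformly from the unit sphere, and regard the contractions $T(g),T(h)$ as matrices of maps $V_3^*\to V_2$. Let $r=\operatorname{rank}(T(g)T(h)^+)$, where $^+$ is the Moore–Penrose pseudoinverse. If $T(g)T(h)^+$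 does not have $r$ distinct non-zero eigenvalues in $\mathbb F$, output "Fail"; otherwise let $\lambda_1,\dots,\lambda_r$ be these eigenvalues, with eigenvectors $y_1,\dots,y_r\in V_2$. If the set of non-zero eigenvalues of $(T(g)^+T(h))^{\mathsf T}$, an endomorphism of $V_3$, is not $\{\lambda_1^{-1},\dots,\lambda_r^{-1}\}$, output "Fail"; otherwise let $z_1,\dots,z_r\in V_3$ be eigenvectors for $\lambda_1^{-1},\dots,\lambda_r^{-1}$. Choose functionals $h_1,\dots,h_r$ on $V_2\otimes V_3$ with $h_a(y_b\otimes z_b)=\delta_{ab}$, and put $w_a=T(h_a)\in V_1$. If $w_a\in\operatorname{span}\{w_b\}$ for some $a\ne b$, output "Fail"; otherwise output the decomposition $\{w_a\otimes y_a\otimes z_a\}$. **Theorem.** 1. There is a Zariski open dense subset $A\subseteq V^{R}$ such that for all $(v_1,\dots,v_R)\in A$ the vectors $v_1,\dots,v_R$ are linearly independent, $U:=\operatorname{span}\{v_1,\dots,v_R\}$ satisfies $U\cap X=\{0\}$, and on input any basis of $U$ Algorithm 2 outputs "$U$ trivially intersects $X$". 2. There is a Zariski open dense subset $B\subseteq X\times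 V^{R-1}$ such that for all $(v_1,\dots,v_R)\in B$ the vectors $v_1,\dots,v_R$ are linearly independent and, on input any basis of $U:=\operatorname{span}\{v_1,\dots,v_R\}$, Algorithm 2 outputs a set of vectors that contains a non-zero multiple of $v_1\in U\cap X$. Here "outputs" means with probability one over the random functionals drawn by the calls of the simultaneous diagonalization algorithm, for every choice of the bases $P_1,\dots,P_s$, eigenvectors, dual functionals and scalings made in the algorithms. -/

import Mathlib

open scoped Matrix Nat Topology

/-! ### The Zariski topology, varieties, non-degeneracy -/

/-- The common zero set in `F^σ` of a family of polynomials. -/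
def polyZeroSet {σ F : Type*} [Field F] (S : Set (MvPolynomial σ F)) : Set (σ → F) :=
  {x | ∀ g ∈ S, MvPolynomial.eval x g = 0}

/-- The Zariski topology on `F^σ`: the closed sets are the zero sets of families of
polynomials. It is not registered as an instance. -/
@[reducible]
def zariskiTopology (σ F : Type*) [Field F] : TopologicalSpace (σ → F) :=
  TopologicalSpace.ofClosed {Z | ∃ S : Set (MvPolynomial σ F), Z = polyZeroSet S}
    ⟨{1}, by ext x; simp [polyZeroSet]⟩
    (by
      intro A hA
      refine ⟨{g | ∃ S, polyZeroSet S ∈ A ∧ g ∈ S}, ?_⟩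
      ext x
      constructor
      · rintro hx g ⟨S, hS, hg⟩
        exact hx _ hS g hg
      · intro hx Z hZ
        obtain ⟨S, rfl⟩ := hA hZ
        exact fun g hg => hx g ⟨S, hZ, hg⟩)
    (by
      rintro _ ⟨S, rfl⟩ _ ⟨T, rfl⟩
      refine ⟨{g | ∃ a ∈ S, ∃ b ∈ T, g = a * b}, ?_⟩
      ext x
      constructor
      · rintro (hx | hx)
        · rintro _ ⟨a, ha, b, hb, rfl⟩
          simp [hx a ha]
        · rintro _ ⟨a, ha, b, hb, rfl⟩
          simp [hx b hb]
      · intro hx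
        by_contra hcon
        simp only [Set.mem_union, not_or] at hcon
        obtain ⟨h1, h2⟩ := hcon
        simp only [polyZeroSet, Set.mem_ofPred_eq, not_forall] at h1 h2
        obtain ⟨a, ha, ha'⟩ := h1
        obtain ⟨b, hb, hb'⟩ := h2
        have hab := hx (a * b) ⟨a, ha, b, hb, rfl⟩
        rw [map_mul] at hab
        exact (mul_ne_zero ha' hb') hab)

/-- The Zariski topology on the space `V^R` of `R`-tuples of vectors of `V = F^n`, which is an
affine space with coordinates indexed by `Fin R × Fin n`. -/
@[reducible]
def zariskiTopologyTuple (R n : ℕ) (F : Type*) [Field F] :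
    TopologicalSpace (Fin R → Fin n → F) :=
  TopologicalSpace.induced (fun v (q : Fin R × Fin n) => v q.1 q.2)
    (zariskiTopology (Fin R × Fin n) F)

/-- `A` is a Zariski open dense subset of `Y ⊆ V^R` (for the induced topology on `Y`). -/
def IsZariskiOpenDenseIn {R n : ℕ} {F : Type*} [Field F] (A Y : Set (Fin R → Fin n → F)) : Prop :=
  (∃ O, IsOpen[zariskiTopologyTuple R n F] O ∧ A = O ∩ Y) ∧
    Y ⊆ @closure _ (zariskiTopologyTuple R n F) A

/-- A set of vectors that is stable under all scalars. -/
def IsConic {n : ℕ} {F : Type*} [Field F] (X : Set (Fin n → F)) : Prop :=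
  ∀ (c : F), ∀ x ∈ X, c • x ∈ X

/-- `C 0, …, C (k-1)` are the irreducible components of the variety `X`: irreducible varieties
with union `X`, none of which contains another one. -/
structure IsIrreducibleComponents {n k : ℕ} {F : Type*} [Field F]
    (X : Set (Fin n → F)) (C : Fin k → Set (Fin n → F)) : Prop where
  isClosed : ∀ i, IsClosed[zariskiTopology (Fin n) F] (C i)
  isIrreducible : ∀ i, @IsIrreducible _ (zariskiTopology (Fin n) F) (C i)
  iUnion_eq : (⋃ i, C i) = X
  irredundant : ∀ i j, i ≠ j → ¬ C i ⊆ C j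

/-- Non-degenerate of order `m`: no non-zero homogeneous polynomial of degree `m` vanishes
on `X`. -/
def IsNondegenerateOfOrder {n : ℕ} {F : Type*} [Field F] (m : ℕ) (X : Set (Fin n → F)) : Prop :=
  ∀ g : MvPolynomial (Fin n) F, g.IsHomogeneous m →
    (∀ x ∈ X, MvPolynomial.eval x g = 0) → g = 0

/-! ### Tensors -/

/-- Tensors in `(F^n)^{⊗ d}`, as arrays of coordinates in the standard basis. -/
abbrev Tensor (F : Type*) (n d : ℕ) : Type _ := (Fin d → Fin n) → F

/-- The product tensor `y 0 ⊗ ⋯ ⊗ y (d-1)`. -/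
def tensorProd {F : Type*} [Field F] {n d : ℕ} (y : Fin d → Fin n → F) : Tensor F n d :=
  fun a => ∏ j, y j (a j)

/-- The tensor power `x^{⊗ d}`. -/
def tensorPow {F : Type*} [Field F] {n : ℕ} (d : ℕ) (x : Fin n → F) : Tensor F n d :=
  tensorProd fun _ => x

/-- `S^d(V)`: the tensors that are invariant under all permutations of the `d` factors. -/
def symTensors (F : Type*) [Field F] (n d : ℕ) : Submodule F (Tensor F n d) where
  carrier := {t | ∀ (σ : Equiv.Perm (Fin d)) (a : Fin d → Fin n), t (a ∘ σ) = t a}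
  add_mem' := fun hs ht σ a => by simp only [Pi.add_apply, hs σ a, ht σ a]
  zero_mem' := fun _ _ => rfl
  smul_mem' := fun c t ht σ a => by simp only [Pi.smul_apply, ht σ a]

/-- `S^d(U)` for a linear subspace `U ⊆ V`: the symmetric tensors in `U^{⊗ d}`. -/
def symPower {F : Type*} [Field F] {n : ℕ} (d : ℕ) (U : Submodule F (Fin n → F)) :
    Submodule F (Tensor F n d) :=
  symTensors F n d ⊓ Submodule.span F {t | ∃ y : Fin d → Fin n → F, (∀ j, y j ∈ U) ∧ t = tensorProd y}

/-- The symmetric tensor in `S^d(V*)` that corresponds to the homogeneous polynomial `g` of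
degree `d`: the product of the coordinate forms `x_{a 0}, …, x_{a (d-1)}` corresponds to the
average of their tensor product over all permutations of the factors, so the monomial `x^m`
with `|m| = d` has the coordinate `∏ (m i)! / d!` at the `d! / ∏ (m i)!` positions `a` in which
each index `i` occurs `m i` times, and the coordinate `0` elsewhere. -/
noncomputable def polyTensor {F : Type*} [Field F] {n : ℕ} (d : ℕ) (g : MvPolynomial (Fin n) F) :
    Tensor F n d := fun a =>
  let m : Fin n →₀ ℕ := ∑ j, Finsupp.single (a j) 1
  g.coeff m * ((∏ i, (m i)! : ℕ) : F) / ((d ! : ℕ) : F)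

/-- The tensors that are annihilated by every element of `I_d = span {f 0, …, f (p-1)}`,
where `I_d` is regarded as a subspace of `S^d(V*)`. -/
def formsPerp {F : Type*} [Field F] {n p : ℕ} (d : ℕ) (f : Fin p → MvPolynomial (Fin n) F) :
    Submodule F (Tensor F n d) where
  carrier := {t | ∀ g ∈ Submodule.span F (Set.range f), ∑ a, polyTensor d g a * t a = 0}
  add_mem' := fun hs ht g hg => by
    simp only [Pi.add_apply, mul_add, Finset.sum_add_distrib, hs g hg, ht g hg, add_zero]
  zero_mem' := fun _ _ => by simp
  smul_mem' := fun c t ht g hg => by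
    have h : ∀ a, polyTensor d g a * (c • t) a = c * (polyTensor d g a * t a) := fun a => by
      simp only [Pi.smul_apply, smul_eq_mul]; ring
    simp only [h, ← Finset.mul_sum, ht g hg, mul_zero]

/-- The space `S^d(U) ∩ I_d^⊥`, where `U` is the span of the vectors `u`. -/
def liftedIntersection {F : Type*} [Field F] {n R p : ℕ} (d : ℕ) (u : Fin R → Fin n → F)
    (f : Fin p → MvPolynomial (Fin n) F) : Submodule F (Tensor F n d) :=
  symPower d (Submodule.span F (Set.range u)) ⊓ formsPerp d f

/-- The multi-index `(a, b 0, …, b (d-2))`, which identifies `V ⊗ V^{⊗ (d-1)}` with `V^{⊗ d}`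
for `d ≥ 1`. -/
def consIndex {n d : ℕ} (a : Fin n) (b : Fin (d - 1) → Fin n) : Fin d → Fin n := fun j =>
  if h : j.val = 0 then a else b ⟨j.val - 1, by have := j.isLt; omega⟩

/-! ### The Moore–Penrose pseudoinverse -/

/-- The four Penrose conditions. -/
structure IsPenroseInverse {F ι κ : Type*} [RCLike F] [Fintype ι] [Fintype κ]
    (A : Matrix ι κ F) (B : Matrix κ ι F) : Prop where
  left : A * B * A = A
  right : B * A * B = B
  herm_left : (A * B)ᴴ = A * B
  herm_right : (B * A)ᴴ = B * A

open scoped ComplexOrder in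
/-- Every matrix has a Moore–Penrose pseudoinverse. -/
theorem exists_isPenroseInverse {F ι κ : Type*} [RCLike F] [Fintype ι] [Fintype κ]
    (A : Matrix ι κ F) : ∃ B : Matrix κ ι F, IsPenroseInverse A B := by
  classical
  have hH : (Aᴴ * A).IsHermitian := Matrix.isHermitian_conjTranspose_mul_self A
  obtain ⟨G, hG, h1, h3, h2⟩ : ∃ G : Matrix κ κ F, Gᴴ = G ∧ (Aᴴ * A) * G = G * (Aᴴ * A) ∧
      (Aᴴ * A) * G * (Aᴴ * A) = Aᴴ * A ∧ G * (Aᴴ * A) * G = G := by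
    have hs := hH.spectral_theorem
    rw [Unitary.conjStarAlgAut_apply] at hs
    set W : Matrix κ κ F := (hH.eigenvectorUnitary : Matrix κ κ F) with hW
    have hWW : star W * W = 1 := Unitary.coe_star_mul_self hH.eigenvectorUnitary
    set D : κ → F := RCLike.ofReal ∘ hH.eigenvalues with hD
    have key : ∀ a b : κ → F, (W * Matrix.diagonal a * star W) * (W * Matrix.diagonal b * star W)
        = W * Matrix.diagonal (fun i => a i * b i) * star W := by
      intro a b
      calc _ = W * Matrix.diagonal a * (star W * W) * Matrix.diagonal b * star W := by
            simp only [Matrix.mul_assoc]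
        _ = _ := by
            rw [hWW, Matrix.mul_one, Matrix.mul_assoc W, Matrix.diagonal_mul_diagonal]
    refine ⟨W * Matrix.diagonal (fun i => (D i)⁻¹) * star W, ?_, ?_, ?_, ?_⟩
    · rw [Matrix.star_eq_conjTranspose]
      simp only [Matrix.conjTranspose_mul, Matrix.conjTranspose_conjTranspose,
        Matrix.diagonal_conjTranspose, Matrix.mul_assoc]
      congr 3
      ext i
      simp [hD]
    · rw [hs, key, key]
      simp only [mul_comm]
    · rw [hs, key, key]
      congr 3
      ext i
      exact mul_inv_mul_cancel (D i)
    · rw [hs, key, key]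
      congr 3
      ext i
      simpa using mul_inv_mul_cancel (D i)⁻¹
  have hA : A * G * (Aᴴ * A) = A := by
    rw [← sub_eq_zero, ← Matrix.conjTranspose_mul_self_eq_zero]
    have h4 : (A * G * (Aᴴ * A) - A)ᴴ = (Aᴴ * A) * G * Aᴴ - Aᴴ := by
      simp only [Matrix.conjTranspose_sub, Matrix.conjTranspose_mul,
        Matrix.conjTranspose_conjTranspose, hG, Matrix.mul_assoc]
    have h5 : ((Aᴴ * A) * G * Aᴴ - Aᴴ) * (A * G * (Aᴴ * A) - A)
        = ((Aᴴ * A) * G * (Aᴴ * A)) * G * (Aᴴ * A) - (Aᴴ * A) * G * (Aᴴ * A)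
          - ((Aᴴ * A) * G * (Aᴴ * A) - Aᴴ * A) := by
      simp only [Matrix.sub_mul, Matrix.mul_sub, Matrix.mul_assoc]
    rw [h4, h5, h3, h3]
    simp
  refine ⟨G * Aᴴ, ?_, ?_, ?_, ?_⟩
  · simpa only [Matrix.mul_assoc] using hA
  · calc _ = G * (Aᴴ * A) * G * Aᴴ := by simp only [Matrix.mul_assoc]
      _ = _ := by rw [h2]
  · simp only [Matrix.conjTranspose_mul, Matrix.conjTranspose_conjTranspose, hG, Matrix.mul_assoc]
  · rw [Matrix.mul_assoc, Matrix.conjTranspose_mul, hH.eq, hG, h1]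

/-- The Moore–Penrose pseudoinverse of a matrix. -/
noncomputable def pinv {F ι κ : Type*} [RCLike F] [Fintype ι] [Fintype κ]
    (A : Matrix ι κ F) : Matrix κ ι F :=
  (exists_isPenroseInverse A).choose

/-! ### The simultaneous diagonalization algorithm -/

/-- The non-zero eigenvalues in `F` of a square matrix. -/
def nonzeroEigenvalues {F ι : Type*} [Field F] [Fintype ι] (M : Matrix ι ι F) : Set F :=
  {μ | μ ≠ 0 ∧ ∃ x : ι → F, x ≠ 0 ∧ M *ᵥ x = μ • x}

/-- The contraction `T(h) = ∑ i, h i • T i` of a tensor `T ∈ V₁ ⊗ V₂ ⊗ V₃`, given by its slices,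
with the linear functional on `V₁` that has the coordinates `h`. It is a matrix of the
map `V₃* → V₂`. -/
def contract {F ι₁ ι₂ ι₃ : Type*} [Field F] [Fintype ι₁] (T : ι₁ → Matrix ι₂ ι₃ F) (h : ι₁ → F) :
    Matrix ι₂ ι₃ F :=
  ∑ i, h i • T i

/-- The vector `T(h) ∈ V₁`, for `T ∈ V₁ ⊗ V₂ ⊗ V₃` and a linear functional `h`
on `V₂ ⊗ V₃`. -/
def contractPair {F ι₁ ι₂ ι₃ : Type*} [Field F] [Fintype ι₂] [Fintype ι₃]
    (T : ι₁ → Matrix ι₂ ι₃ F) (h : ι₂ → ι₃ → F) : ι₁ → F :=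
  fun i => ∑ b, ∑ c, h b c * T i b c

/-- The possible outputs of the simultaneous diagonalization algorithm: `Fail`, or a list of
`r` product tensors `x a ⊗ y a ⊗ z a`. -/
inductive SimDiagOutput (F ι₁ ι₂ ι₃ : Type*) where
  | fail : SimDiagOutput F ι₁ ι₂ ι₃
  | decomposition (r : ℕ) (x : Fin r → ι₁ → F) (y : Fin r → ι₂ → F) (z : Fin r → ι₃ → F) :
      SimDiagOutput F ι₁ ι₂ ι₃

section SimDiag

variable {F ι₁ ι₂ ι₃ : Type*} [RCLike F] [Fintype ι₁] [Fintype ι₂] [Fintype ι₃]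

/-- The matrix `T(η) T(θ)⁺`, an endomorphism of `V₂`. -/
noncomputable def simDiagLeft (T : ι₁ → Matrix ι₂ ι₃ F) (η θ : ι₁ → F) : Matrix ι₂ ι₂ F :=
  contract T η * pinv (contract T θ)

/-- The matrix `T(η)⁺ T(θ)`, an endomorphism of `V₃*`, transposed to an endomorphism of `V₃`. -/
noncomputable def simDiagRight (T : ι₁ → Matrix ι₂ ι₃ F) (η θ : ι₁ → F) : Matrix ι₃ ι₃ F :=
  (pinv (contract T η) * contract T θ)ᵀ

/-- `lam` enumerates, without repetition, the non-zero eigenvalues of `M`, and their number is the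
rank of `M`. -/
def IsSimpleSpectrum {ι : Type*} [Fintype ι] {r : ℕ} (M : Matrix ι ι F) (lam : Fin r → F) : Prop :=
  r = M.rank ∧ Function.Injective lam ∧ Set.range lam = nonzeroEigenvalues M

/-- `x a` is an eigenvector of `M` for the eigenvalue `lam a`. -/
def AreEigenvectors {ι : Type*} [Fintype ι] {r : ℕ} (M : Matrix ι ι F) (lam : Fin r → F)
    (x : Fin r → ι → F) : Prop :=
  ∀ a, x a ≠ 0 ∧ M *ᵥ x a = lam a • x a

/-- `h` is a family of linear functionals on `V₂ ⊗ V₃` that is dual to the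
family `y a ⊗ z a`. -/
def AreDual {r : ℕ} (y : Fin r → ι₂ → F) (z : Fin r → ι₃ → F) (h : Fin r → ι₂ → ι₃ → F) : Prop :=
  ∀ a a', ∑ b, ∑ c, h a b c * (y a' b * z a' c) = if a = a' then 1 else 0

/-- `SimDiagRun T η θ o`: the simultaneous diagonalization algorithm can output `o` on the
input `T` when `η` and `θ` are the two functionals that it has drawn at random. The remaining
freedom is the order of the eigenvalues and the choice of the eigenvectors and of the dual
functionals. -/
inductive SimDiagRun (T : ι₁ → Matrix ι₂ ι₃ F) (η θ : ι₁ → F) : SimDiagOutput F ι₁ ι₂ ι₃ → Prop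
  | fail_left
      (h : ¬ ∃ (r : ℕ) (lam : Fin r → F), IsSimpleSpectrum (simDiagLeft T η θ) lam) :
      SimDiagRun T η θ .fail
  | fail_right {r : ℕ} (lam : Fin r → F)
      (hlam : IsSimpleSpectrum (simDiagLeft T η θ) lam)
      (h : nonzeroEigenvalues (simDiagRight T η θ) ≠ Set.range (fun a => (lam a)⁻¹)) :
      SimDiagRun T η θ .fail
  | fail_parallel {r : ℕ} (lam : Fin r → F) (y : Fin r → ι₂ → F) (z : Fin r → ι₃ → F)
      (h : Fin r → ι₂ → ι₃ → F)
      (hlam : IsSimpleSpectrum (simDiagLeft T η θ) lam)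
      (hright : nonzeroEigenvalues (simDiagRight T η θ) = Set.range (fun a => (lam a)⁻¹))
      (hy : AreEigenvectors (simDiagLeft T η θ) lam y)
      (hz : AreEigenvectors (simDiagRight T η θ) (fun a => (lam a)⁻¹) z)
      (hh : AreDual y z h)
      (hpar : ∃ a b, a ≠ b ∧ contractPair T (h a) ∈ Submodule.span F {contractPair T (h b)}) :
      SimDiagRun T η θ .fail
  | success {r : ℕ} (lam : Fin r → F) (y : Fin r → ι₂ → F) (z : Fin r → ι₃ → F)
      (h : Fin r → ι₂ → ι₃ → F)
      (hlam : IsSimpleSpectrum (simDiagLeft T η θ) lam)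
      (hright : nonzeroEigenvalues (simDiagRight T η θ) = Set.range (fun a => (lam a)⁻¹))
      (hy : AreEigenvectors (simDiagLeft T η θ) lam y)
      (hz : AreEigenvectors (simDiagRight T η θ) (fun a => (lam a)⁻¹) z)
      (hh : AreDual y z h)
      (hpar : ¬ ∃ a b, a ≠ b ∧ contractPair T (h a) ∈ Submodule.span F {contractPair T (h b)}) :
      SimDiagRun T η θ (.decomposition r (fun a => contractPair T (h a)) y z)

end SimDiag

/-! ### Computing the intersection of a subspace with one variety -/

/-- The possible outputs of the intersection algorithm: `U` trivially intersects `X`, or the only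
elements of `U ∩ X` are `x 0, …, x (s-1)` up to scale, or `Fail`. -/
inductive IntersectOutput (F : Type*) (n : ℕ) where
  | trivial : IntersectOutput F n
  | only (s : ℕ) (x : Fin s → Fin n → F) : IntersectOutput F n
  | fail : IntersectOutput F n

/-- The vectors that an output of the intersection algorithm reports. -/
def IntersectOutput.reported {F : Type*} {n : ℕ} : IntersectOutput F n → Set (Fin n → F)
  | .trivial => ∅
  | .only _ x => Set.range x
  | .fail => ∅

section Intersect

variable {F : Type*} [RCLike F] {n R p : ℕ}

/-- The tensor `∑ i, e_i ⊗ P i` in `F^s ⊗ V ⊗ V^{⊗ (d-1)}`, given by its `s` slices. -/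
def sliceTensor {s d : ℕ} (P : Fin s → Tensor F n d) :
    Fin s → Matrix (Fin n) (Fin (d - 1) → Fin n) F :=
  fun i => Matrix.of fun a b => P i (consIndex a b)

/-- The output `o` of the simultaneous diagonalization algorithm is a decomposition of
`∑ i, e_i ⊗ P i` into the tensors `c i ⊗ (x i)^{⊗ d}`, with linearly independent `c i` and linearly
independent `x i`. -/
def IsPowerDecomposition {s d : ℕ} (P : Fin s → Tensor F n d)
    (o : SimDiagOutput F (Fin s) (Fin n) (Fin (d - 1) → Fin n))
    (c : Fin s → Fin s → F) (x : Fin s → Fin n → F) : Prop :=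
  LinearIndependent F c ∧ LinearIndependent F x ∧
    (∀ q, P q = ∑ i, c i q • tensorPow d (x i)) ∧
    ∃ x₁ y₁ z₁, o = .decomposition s x₁ y₁ z₁ ∧
      ∀ i q a b, x₁ i q * y₁ i a * z₁ i b = c i q * tensorPow d (x i) (consIndex a b)

/-- `IntersectRun d u f P η θ o`: the intersection algorithm can output `o` on the basis `u` of `U`
and the forms `f` of degree `d`, when `P` is the basis of `S^d(U) ∩ I_d^⊥` that it computes
and `η`, `θ` are the two functionals that its call of the simultaneous diagonalization
algorithm draws at random. -/
inductive IntersectRun (d : ℕ) (u : Fin R → Fin n → F) (f : Fin p → MvPolynomial (Fin n) F) {s : ℕ}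
    (P : Module.Basis (Fin s) F (liftedIntersection d u f)) (η θ : Fin s → F) :
    IntersectOutput F n → Prop
  | trivial (h : liftedIntersection d u f = ⊥) : IntersectRun d u f P η θ .trivial
  | fail_size (h : liftedIntersection d u f ≠ ⊥) (hs : R < s) : IntersectRun d u f P η θ .fail
  | only (h : liftedIntersection d u f ≠ ⊥) (hs : s ≤ R)
      (o : SimDiagOutput F (Fin s) (Fin n) (Fin (d - 1) → Fin n))
      (ho : SimDiagRun (sliceTensor fun i => (P i : Tensor F n d)) η θ o)
      (c : Fin s → Fin s → F) (x : Fin s → Fin n → F)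
      (hx : IsPowerDecomposition (fun i => (P i : Tensor F n d)) o c x) :
      IntersectRun d u f P η θ (.only s x)
  | fail_decomposition (h : liftedIntersection d u f ≠ ⊥) (hs : s ≤ R)
      (o : SimDiagOutput F (Fin s) (Fin n) (Fin (d - 1) → Fin n))
      (ho : SimDiagRun (sliceTensor fun i => (P i : Tensor F n d)) η θ o)
      (hx : ¬ ∃ c x, IsPowerDecomposition (fun i => (P i : Tensor F n d)) o c x) :
      IntersectRun d u f P η θ .fail

end Intersect

/-! ### Running the algorithm on every irreducible component -/

/-- The possible outputs of the componentwise algorithm: `U` trivially intersects `X`, or a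
set of non-zero elements of `U ∩ X`, or `Fail`. -/
inductive ComponentsOutput (F : Type*) (n : ℕ) where
  | trivial : ComponentsOutput F n
  | found (S : Set (Fin n → F)) : ComponentsOutput F n
  | fail : ComponentsOutput F n

open Classical in
/-- The output of the componentwise algorithm, given the outputs of the intersection algorithm
on all components: the non-zero vectors that were found, if there are any; otherwise that `U`
trivially intersects `X`, if that was the output on every component; otherwise `Fail`. -/
noncomputable def combineOutputs {F : Type*} [Field F] {n k : ℕ} (o : Fin k → IntersectOutput F n) :
    ComponentsOutput F n :=
  if {x | x ≠ 0 ∧ ∃ i, x ∈ (o i).reported}.Nonempty then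
    .found {x | x ≠ 0 ∧ ∃ i, x ∈ (o i).reported}
  else if ∀ i, o i = .trivial then .trivial
  else .fail

/-- The uniform probability measure on the unit sphere of `F^s`, as a measure on `F^s`. For `s = 0`,
where the sphere is empty (and the algorithm draws nothing), it is the point mass at `0`. -/
noncomputable def uniformSphere (F : Type*) [RCLike F] (s : ℕ) :
    MeasureTheory.Measure (EuclideanSpace F (Fin s)) :=
  let σ : MeasureTheory.Measure (Metric.sphere (0 : EuclideanSpace F (Fin s)) 1) :=
    MeasureTheory.Measure.addHaar.toSphere
  if s = 0 then MeasureTheory.Measure.dirac 0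
  else (σ Set.univ)⁻¹ • σ.map Subtype.val

section Components

variable {F : Type*} [RCLike F] {n k R : ℕ}

/-- The size of the basis computed by the intersection algorithm on the forms `f`. -/
noncomputable abbrev liftedDim {p : ℕ} (d : ℕ) (u : Fin R → Fin n → F)
    (f : Fin p → MvPolynomial (Fin n) F) : ℕ :=
  Module.finrank F (liftedIntersection d u f)

/-- The componentwise algorithm can output `o` on the basis `u` of `U` and the forms `f i` of degree
`d i` that cut out the `i`-th component, when `P i` is the basis of `S^{d i}(U) ∩ I_{d i}^⊥`
computed for the `i`-th component and `ω i` is the pair of functionals drawn there. -/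
def ComponentsRun (d : Fin k → ℕ) (u : Fin R → Fin n → F) {p : Fin k → ℕ}
    (f : ∀ i, Fin (p i) → MvPolynomial (Fin n) F)
    (P : ∀ i, Module.Basis (Fin (liftedDim (d i) u (f i))) F (liftedIntersection (d i) u (f i)))
    (ω : ∀ i, EuclideanSpace F (Fin (liftedDim (d i) u (f i))) ×
      EuclideanSpace F (Fin (liftedDim (d i) u (f i))))
    (o : ComponentsOutput F n) : Prop :=
  ∃ o' : Fin k → IntersectOutput F n,
    (∀ i, IntersectRun (d i) u (f i) (P i) (ω i).1 (ω i).2 (o' i)) ∧ o = combineOutputs o'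

/-- On the basis `u` of `U` and the forms `f i` of degree `d i`, the componentwise algorithm
terminates with an output that satisfies `Q`, with probability one over the independent
uniform choices of its functionals, however its other choices are made. -/
def ComponentsAlgorithmOutputs (d : Fin k → ℕ) (u : Fin R → Fin n → F) {p : Fin k → ℕ}
    (f : ∀ i, Fin (p i) → MvPolynomial (Fin n) F) (Q : ComponentsOutput F n → Prop) : Prop :=
  ∀ P : ∀ i, Module.Basis (Fin (liftedDim (d i) u (f i))) F (liftedIntersection (d i) u (f i)),
    ∀ᵐ ω ∂(MeasureTheory.Measure.pi fun i =>
      (uniformSphere F (liftedDim (d i) u (f i))).prod (uniformSphere F (liftedDim (d i) u (f i)))),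
      (∃ o, ComponentsRun d u f P ω o) ∧ ∀ o, ComponentsRun d u f P ω o → Q o

end Components

/-! ### Directional derivatives of polynomials -/

section DirDeriv

variable {F : Type*} {n : ℕ}

/-! Everything rests on the space S^d(U) ∩ I_d^⊥ of a single component. For a generic tuple it is
zero, and for a generic tuple with v_1 in that component it is the line spanned by v_1^{⊗d}. In the
first case the algorithm answers at once. In the second case every contraction is a multiple of one
rank-one matrix, and the diagonalization succeeds whenever both random functionals are non-zero,
which has probability one (`IntersectRun.exists_smul_mem_reported`, `ae_uniformSphere_ne_zero`).

Pairing a form g with a tensor of S^d(U) gives a linear combination of the constants D^b g, where b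
runs over the exponents of degree d and D^b is the iterated derivative along v_1, …, v_R
(`exists_pairing_eq_sum`). Up to factorials these are the coefficients of g restricted to U. It
therefore suffices that the functionals g ↦ D^b g are linearly independent on I_d, for all b in part
1 and for all b except the pure power of v_1 in part 2; this is `SeparatesExponents`. The condition
is Zariski open in the tuple, so by irreducibility of V^R and of X_i × V^{R-1} a single good tuple
is enough.

That tuple comes from `exists_directions_leading`: there are w_1, …, w_{R-1} such that for every
exponent a of degree at most d some g in I_d has D^a g ≠ 0 and D^b g = 0 for all lexicographically
larger b. The form D^a g has degree d - |a|. A v_1 outside the zero sets of the finitely many forms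
needed exists in X_i, because X_i is irreducible and non-degenerate of order d - 1. With this v_1
the system of functionals is triangular (`exists_separatesExponents`).

The directions are chosen one at a time, in the spirit of generic initial spaces. If w maximizes the
sum of the ranks of its derivatives of orders 1, …, d on I, then D_w^{j+1} g = 0 forces D_u D_w^j g
into D_w^{j+1} I for every u, since otherwise the rank would grow at w + εu
(`exists_direction_dirDeriv_mem`). Passing from I to the kernel of D_w costs at most binom(n+d-2,
d-1) dimensions, and the bound on R allows this R - 1 times. -/

/-- The derivative of polynomials in the direction `u`. -/
noncomputable def dirDeriv [Field F] :
    (Fin n → F) →ₗ[F] Module.End F (MvPolynomial (Fin n) F) :=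
  Fintype.linearCombination F fun i => (MvPolynomial.pderiv i).toLinearMap

section Field

variable [Field F]

theorem dirDeriv_apply (u : Fin n → F) (g : MvPolynomial (Fin n) F) :
    dirDeriv u g = ∑ i, u i • MvPolynomial.pderiv i g := by
  simp [dirDeriv, Fintype.linearCombination_apply, LinearMap.sum_apply]

theorem coeff_dirDeriv (u : Fin n → F) (g : MvPolynomial (Fin n) F) (m : Fin n →₀ ℕ) :
    (dirDeriv u g).coeff m
      = ∑ i, u i * (g.coeff (m + Finsupp.single i 1) * (m i + 1)) := by
  simp [dirDeriv_apply, MvPolynomial.coeff_sum, MvPolynomial.coeff_pderiv]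

theorem commute_pderiv (i j : Fin n) :
    Commute (MvPolynomial.pderiv (R := F) i).toLinearMap
      (MvPolynomial.pderiv (R := F) j).toLinearMap := by
  refine LinearMap.ext fun g => MvPolynomial.ext _ _ fun m => ?_
  by_cases h : i = j
  · simp [h]
  · simp [MvPolynomial.coeff_pderiv, h, Ne.symm h, add_right_comm m]
    ring

theorem commute_dirDeriv (u w : Fin n → F) : Commute (dirDeriv u) (dirDeriv w) := by
  simp only [dirDeriv, Fintype.linearCombination_apply]
  exact Commute.sum_left _ _ _ fun i _ => Commute.sum_right _ _ _ fun j _ =>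
    ((commute_pderiv i j).smul_left _).smul_right _

theorem MvPolynomial.IsHomogeneous.dirDeriv {d : ℕ} {g : MvPolynomial (Fin n) F}
    (hg : g.IsHomogeneous d) (u : Fin n → F) : (dirDeriv u g).IsHomogeneous (d - 1) := by
  rw [dirDeriv_apply]
  exact (MvPolynomial.homogeneousSubmodule (Fin n) F (d - 1)).sum_mem fun i _ =>
    Submodule.smul_mem _ _ hg.pderiv

theorem MvPolynomial.IsHomogeneous.dirDeriv_pow {d : ℕ} {g : MvPolynomial (Fin n) F}
    (hg : g.IsHomogeneous d) (u : Fin n → F) (k : ℕ) :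
    ((_root_.dirDeriv u ^ k) g).IsHomogeneous (d - k) := by
  induction k with
  | zero => simpa using hg
  | succ k ih =>
    rw [pow_succ', Module.End.mul_apply, Nat.sub_add_eq]
    exact ih.dirDeriv u

theorem MvPolynomial.IsHomogeneous.eval_dirDeriv_self {d : ℕ} {g : MvPolynomial (Fin n) F}
    (hg : g.IsHomogeneous d) (u : Fin n → F) :
    MvPolynomial.eval u (_root_.dirDeriv u g) = d * MvPolynomial.eval u g := by
  have h := congrArg (MvPolynomial.eval u) hg.sum_X_mul_pderiv
  simpa [dirDeriv_apply, MvPolynomial.smul_eval] using h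

/-- Euler's identity, iterated: each derivative lowers the degree by one, so the factors d, d - 1, …
accumulate. -/
theorem MvPolynomial.IsHomogeneous.eval_dirDeriv_pow_self {d : ℕ} {g : MvPolynomial (Fin n) F}
    (hg : g.IsHomogeneous d) (u : Fin n → F) (k : ℕ) :
    MvPolynomial.eval u ((_root_.dirDeriv u ^ k) g) = d.descFactorial k * MvPolynomial.eval u g := by
  induction k with
  | zero => simp
  | succ k ih =>
    rw [pow_succ', Module.End.mul_apply, (hg.dirDeriv_pow u k).eval_dirDeriv_self, ih,
      Nat.descFactorial_succ]
    push_cast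
    ring

theorem MvPolynomial.IsHomogeneous.eq_C_coeff_zero {g : MvPolynomial (Fin n) F}
    (hg : g.IsHomogeneous 0) : g = MvPolynomial.C (g.coeff 0) := by
  rw [← MvPolynomial.totalDegree_zero_iff_isHomogeneous] at hg
  exact MvPolynomial.totalDegree_eq_zero_iff_eq_C.1 hg

/-- The full derivative of a form of degree `d` in the direction `u` is `d!` times its value. -/
theorem MvPolynomial.IsHomogeneous.coeff_zero_dirDeriv_pow {d : ℕ} {g : MvPolynomial (Fin n) F}
    (hg : g.IsHomogeneous d) (u : Fin n → F) :
    ((_root_.dirDeriv u ^ d) g).coeff 0 = d ! * MvPolynomial.eval u g := by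
  have h := hg.eval_dirDeriv_pow_self u d
  have h0 := hg.dirDeriv_pow u d
  rw [Nat.sub_self] at h0
  rw [h0.eq_C_coeff_zero, MvPolynomial.eval_C, Nat.descFactorial_self] at h
  exact h

/-- If the derivative vanished for all u, evaluating it at u itself would give g(u) = 0 by Euler's
identity, because the falling factorial is non-zero in characteristic zero. -/
theorem MvPolynomial.IsHomogeneous.exists_dirDeriv_pow_ne_zero [CharZero F] {d j : ℕ}
    {g : MvPolynomial (Fin n) F} (hg : g.IsHomogeneous d) (h0 : g ≠ 0) (hj : j ≤ d) :
    ∃ u : Fin n → F, (_root_.dirDeriv u ^ j) g ≠ 0 := by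
  by_contra! h
  refine h0 (MvPolynomial.funext fun u => ?_)
  have h1 := hg.eval_dirDeriv_pow_self u j
  rw [h u, map_zero, eq_comm, mul_eq_zero] at h1
  rcases h1 with h1 | h1
  · exact absurd (Nat.cast_eq_zero.1 h1) (Nat.descFactorial_pos.2 hj).ne'
  · simpa using h1

/-- The monomials of degree d span, and they are indexed by the multisets of size d. -/
theorem MvPolynomial.finrank_homogeneousSubmodule_le (n d : ℕ) (F : Type*) [Field F] :
    Module.finrank F (MvPolynomial.homogeneousSubmodule (Fin n) F d)
      ≤ (n + d - 1).choose d := by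
  classical
  have hle : MvPolynomial.homogeneousSubmodule (Fin n) F d ≤ Submodule.span F
      (Set.range fun s : Sym (Fin n) d =>
        MvPolynomial.monomial (Multiset.toFinsupp (s : Multiset (Fin n))) (1 : F)) := by
    intro g hg
    rw [g.as_sum]
    refine Submodule.sum_mem _ fun m hm => ?_
    have hdeg : m.degree = d := by
      rw [Finsupp.degree_eq_weight_one]
      exact hg (MvPolynomial.mem_support_iff.1 hm)
    rw [← mul_one (g.coeff m), ← smul_eq_mul, ← MvPolynomial.smul_monomial]
    refine Submodule.smul_mem _ _ (Submodule.subset_span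
      ⟨⟨Finsupp.toMultiset m, by rw [Finsupp.card_toMultiset]; exact hdeg⟩, ?_⟩)
    simp
  have : Module.Finite F (Submodule.span F
      (Set.range fun s : Sym (Fin n) d =>
        MvPolynomial.monomial (Multiset.toFinsupp (s : Multiset (Fin n))) (1 : F))) :=
    Module.Finite.span_of_finite F (Set.finite_range _)
  refine (Submodule.finrank_mono hle).trans ((finrank_range_le_card _).trans ?_)
  rw [Sym.card_sym_eq_choose, Fintype.card_fin]

end Field

end DirDeriv

/-! ### Semicontinuity of the rank of directional derivatives on a space of polynomials -/

section RankSemicontinuity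

variable {F : Type*} [RCLike F]

/-- Linear independence of a family that depends polynomially on a parameter is an open
condition. -/
theorem eventually_linearIndependent_sum_pow_smul {E ι : Type*} [AddCommGroup E] [Module F E]
    [Finite ι] (e : ι → ℕ → E) (N : ι → ℕ) (h : LinearIndependent F fun i => e i 0) :
    ∀ᶠ ε in 𝓝 (0 : F),
      LinearIndependent F fun i => ∑ m ∈ Finset.range (N i + 1), ε ^ m • e i m := by
  classical
  have := Fintype.ofFinite ι
  -- A left inverse at ε = 0 turns independence into the non-vanishing of a determinant that is
  -- continuous in ε and equals 1 at 0.
  obtain ⟨L, hL⟩ := LinearMap.exists_leftInverse_of_injective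
    (Fintype.linearCombination F fun i => e i 0)
    (LinearMap.ker_eq_bot.2 (linearIndependent_iff_injective_fintypeLinearCombination.1 h))
  have hL0 : ∀ i, L (e i 0) = Pi.single i 1 := fun i => by
    have := LinearMap.congr_fun hL (Pi.single i 1)
    simpa [Fintype.linearCombination_apply_single] using this
  set M : F → Matrix ι ι F := fun ε =>
    Matrix.of fun i => L (∑ m ∈ Finset.range (N i + 1), ε ^ m • e i m) with hM
  have hcont : Continuous fun ε => (M ε).det := by
    refine Continuous.matrix_det (continuous_matrix fun i j => ?_)
    simp only [hM, Matrix.of_apply, map_sum, map_smul, Finset.sum_apply, Pi.smul_apply,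
      smul_eq_mul]
    fun_prop
  have h1 : (M 0).det = 1 := by
    have : M 0 = 1 := by
      ext i j
      simp [hM, Finset.sum_range_succ', hL0, Matrix.one_apply, Pi.single_apply, eq_comm]
    rw [this, Matrix.det_one]
  have hne : ∀ᶠ ε in 𝓝 (0 : F), (M ε).det ≠ 0 :=
    hcont.continuousAt.eventually_ne (by rw [h1]; exact one_ne_zero)
  filter_upwards [hne] with ε hε
  exact LinearIndependent.of_comp L (Matrix.linearIndependent_rows_of_det_ne_zero hε)

theorem exists_linearIndependent_map {K E E' : Type*} [Field K] [AddCommGroup E] [Module K E]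
    [AddCommGroup E'] [Module K E'] (A : E →ₗ[K] E') (I : Submodule K E)
    [FiniteDimensional K I] {r : ℕ} (hr : Module.finrank K (I.map A) = r) :
    ∃ h : Fin r → E, (∀ i, h i ∈ I) ∧ LinearIndependent K fun i => A (h i) := by
  subst hr
  have hli := (Module.finBasis K (I.map A)).linearIndependent.map' (I.map A).subtype
    (Submodule.ker_subtype _)
  choose h hI hb using fun i => (Module.finBasis K (I.map A) i).2
  exact ⟨h, hI, (funext hb : (fun i => A (h i)) = _) ▸ hli⟩

variable {n : ℕ}

/-- The binomial theorem for commuting derivations, arranged by powers of the perturbation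
parameter. -/
theorem dirDeriv_add_smul_pow (w u : Fin n → F) (ε : F) (m : ℕ) (g : MvPolynomial (Fin n) F) :
    (dirDeriv (w + ε • u) ^ m) g = ∑ k ∈ Finset.range (m + 1),
      ε ^ k • m.choose k • (dirDeriv u ^ k) ((dirDeriv w ^ (m - k)) g) := by
  rw [map_add, map_smul, add_comm,
    ((commute_dirDeriv u w).smul_left ε).add_pow, LinearMap.sum_apply]
  refine Finset.sum_congr rfl fun k _ => ?_
  rw [smul_pow, ← nsmul_eq_mul', smul_mul_assoc, LinearMap.smul_apply, LinearMap.smul_apply,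
    Module.End.mul_apply, smul_comm]

variable (I : Submodule F (MvPolynomial (Fin n) F)) [FiniteDimensional F I]

theorem eventually_finrank_map_dirDeriv_pow_le (w u : Fin n → F) (m : ℕ) :
    ∀ᶠ ε in 𝓝 (0 : F), Module.finrank F (I.map (dirDeriv w ^ m))
      ≤ Module.finrank F (I.map (dirDeriv (w + ε • u) ^ m)) := by
  obtain ⟨r, hr⟩ : ∃ r, Module.finrank F (I.map (dirDeriv w ^ m)) = r := ⟨_, rfl⟩
  obtain ⟨h, hI, hli⟩ := exists_linearIndependent_map _ I hr
  have hev := eventually_linearIndependent_sum_pow_smul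
    (fun i k => m.choose k • (dirDeriv u ^ k) ((dirDeriv w ^ (m - k)) (h i))) (fun _ => m)
    (by simpa using hli)
  filter_upwards [hev] with ε hε
  rw [hr]
  simp only [← dirDeriv_add_smul_pow] at hε
  have := finrank_span_eq_card hε
  rw [Fintype.card_fin] at this
  rw [← this]
  refine Submodule.finrank_mono (Submodule.span_le.2 ?_)
  rintro _ ⟨i, rfl⟩
  exact Submodule.mem_map_of_mem (hI i)

/-- Since D_w^{m+1} g = 0, the derivative of g along w + εu is divisible by ε. The quotient tends to
(m+1) D_u D_w^m g, a direction outside the old image, so the rank increases for small ε ≠ 0. -/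
theorem eventually_finrank_map_dirDeriv_pow_lt (w u : Fin n → F) (m : ℕ)
    {g : MvPolynomial (Fin n) F} (hg : g ∈ I) (hg0 : (dirDeriv w ^ (m + 1)) g = 0)
    (hne : dirDeriv u ((dirDeriv w ^ m) g) ∉ I.map (dirDeriv w ^ (m + 1))) :
    ∀ᶠ ε in 𝓝[≠] (0 : F), Module.finrank F (I.map (dirDeriv w ^ (m + 1)))
      < Module.finrank F (I.map (dirDeriv (w + ε • u) ^ (m + 1))) := by
  obtain ⟨r, hr⟩ : ∃ r, Module.finrank F (I.map (dirDeriv w ^ (m + 1))) = r := ⟨_, rfl⟩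
  obtain ⟨h, hI, hli⟩ := exists_linearIndependent_map _ I hr
  have hspan : Submodule.span F (Set.range fun i => (dirDeriv w ^ (m + 1)) (h i))
      ≤ I.map (dirDeriv w ^ (m + 1)) :=
    Submodule.span_le.2 (by rintro _ ⟨i, rfl⟩; exact Submodule.mem_map_of_mem (hI i))
  rw [hr]
  set E : MvPolynomial (Fin n) F → ℕ → MvPolynomial (Fin n) F := fun q k =>
    (m + 1).choose k • (dirDeriv u ^ k) ((dirDeriv w ^ (m + 1 - k)) q) with hE
  have hEsum : ∀ q ε, ∑ k ∈ Finset.range (m + 1 + 1), ε ^ k • E q k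
      = (dirDeriv (w + ε • u) ^ (m + 1)) q := fun q ε => (dirDeriv_add_smul_pow w u ε _ q).symm
  -- The index `none` carries the expansion of g divided by ε, hence the shift to `k + 1` and the
  -- length `m` instead of `m + 1`.
  have hev := eventually_linearIndependent_sum_pow_smul (F := F)
    (fun i : Option (Fin r) =>
      i.elim (fun k => E g (k + 1)) fun i => E (h i))
    (fun i => i.elim m fun _ => m + 1) (by
      rw [linearIndependent_option]
      constructor
      · simpa [Function.comp_def, hE] using hli
      · intro hmem
        have hmem' := hspan (by simpa [Function.comp_def, hE] using hmem :
          ((m : MvPolynomial (Fin n) F) + 1) * dirDeriv u ((dirDeriv w ^ m) g) ∈ _)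
        have hc : ((m : F) + 1) ≠ 0 := by exact_mod_cast Nat.succ_ne_zero m
        refine hne ?_
        have := Submodule.smul_mem _ ((m : F) + 1)⁻¹ hmem'
        have heq : ((m : MvPolynomial (Fin n) F) + 1) * dirDeriv u ((dirDeriv w ^ m) g)
            = ((m : F) + 1) • dirDeriv u ((dirDeriv w ^ m) g) := by
          rw [MvPolynomial.smul_eq_C_mul]
          simp
        rwa [heq, inv_smul_smul₀ hc] at this)
  filter_upwards [hev.filter_mono nhdsWithin_le_nhds, self_mem_nhdsWithin] with ε hε hε0
  have hcard := finrank_span_eq_card hε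
  rw [Fintype.card_option, Fintype.card_fin] at hcard
  rw [← Nat.succ_le_iff, Nat.succ_eq_add_one, ← hcard]
  refine Submodule.finrank_mono (Submodule.span_le.2 ?_)
  rintro _ ⟨i | i, rfl⟩
  · have hs := hEsum g ε
    rw [Finset.sum_range_succ'] at hs
    have h0 : E g 0 = 0 := by simp [hE, hg0]
    rw [h0, smul_zero, add_zero] at hs
    refine ⟨ε⁻¹ • g, I.smul_mem _ hg, ?_⟩
    simp only [Option.elim_none, map_smul, ← hs, Finset.smul_sum, smul_smul]
    refine Finset.sum_congr rfl fun k _ => ?_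
    rw [pow_succ', inv_mul_cancel_left₀ hε0]
  · simp only [Option.elim_some, hEsum]
    exact Submodule.mem_map_of_mem (hI i)

/-- In a direction `w` for which the derivatives of `I` of all orders have locally maximal rank,
the leading coefficients of `I` with respect to `w` are stable under directional derivatives. -/
theorem exists_direction_dirDeriv_mem (d : ℕ) :
    ∃ w : Fin n → F, ∀ j < d, ∀ g ∈ I, (dirDeriv w ^ (j + 1)) g = 0 → ∀ u : Fin n → F,
      ∃ g' ∈ I, (dirDeriv w ^ (j + 1)) g' = dirDeriv u ((dirDeriv w ^ j) g) := by
  set rk : ℕ → (Fin n → F) → ℕ := fun j w => Module.finrank F (I.map (dirDeriv w ^ (j + 1)))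
    with hrk
  -- One direction must serve all orders at once. Near a maximum of the sum no single rank drops, so
  -- none can rise either.
  set Φ : (Fin n → F) → ℕ := fun w => ∑ j ∈ Finset.range d, rk j w with hΦ
  have hbound : ∀ w, Φ w ≤ d * Module.finrank F I := fun w => by
    have := Finset.sum_le_card_nsmul (Finset.range d) (fun j => rk j w) (Module.finrank F I)
      fun j _ => Submodule.finrank_map_le _ _
    simpa using this
  obtain ⟨w, hw⟩ : ∃ w, ∀ w', Φ w' ≤ Φ w := by
    refine ⟨Function.argmin fun w => d * Module.finrank F I - Φ w, fun w' => ?_⟩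
    have := Function.argmin_le (fun w => d * Module.finrank F I - Φ w) w'
    have h1 := hbound w'
    have h2 := hbound (Function.argmin fun w => d * Module.finrank F I - Φ w)
    beta_reduce at this
    omega
  refine ⟨w, fun j hj g hg hg0 u => ?_⟩
  by_contra hcon
  have hnot : dirDeriv u ((dirDeriv w ^ j) g) ∉ I.map (dirDeriv w ^ (j + 1)) := by
    rintro ⟨g', h1, h2⟩
    exact hcon ⟨g', h1, h2⟩
  have hle : ∀ᶠ ε in 𝓝[≠] (0 : F), ∀ i ∈ Finset.range d, rk i w ≤ rk i (w + ε • u) := by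
    rw [Filter.eventually_all_finset]
    exact fun i _ =>
      (eventually_finrank_map_dirDeriv_pow_le I w u (i + 1)).filter_mono nhdsWithin_le_nhds
  obtain ⟨ε, h1, h2⟩ :=
    (hle.and (eventually_finrank_map_dirDeriv_pow_lt I w u j hg hg0 hnot)).exists
  exact absurd (hw (w + ε • u))
    (not_le.2 (Finset.sum_lt_sum h1 ⟨j, Finset.mem_range.2 hj, h2⟩))

end RankSemicontinuity

/-! ### Iterated derivatives, their pairing with tensors, and leading exponents -/

section IteratedDerivatives

variable {F : Type*} {n : ℕ}

/-- The iterated directional derivative in which `w i` occurs `a i` times. -/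
noncomputable def dirDerivProd [Field F] {r : ℕ} (w : Fin r → Fin n → F) (a : Fin r → ℕ) :
    Module.End F (MvPolynomial (Fin n) F) :=
  (List.ofFn fun i => dirDeriv (w i) ^ a i).prod

section Field

variable [Field F]

theorem dirDerivProd_succ {r : ℕ} (w : Fin (r + 1) → Fin n → F) (a : Fin (r + 1) → ℕ) :
    dirDerivProd w a = dirDeriv (w 0) ^ a 0 * dirDerivProd (Fin.tail w) (Fin.tail a) := by
  simp [dirDerivProd, List.ofFn_succ, Fin.tail]

theorem commute_dirDeriv_dirDerivProd {r : ℕ} (u : Fin n → F) (w : Fin r → Fin n → F)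
    (a : Fin r → ℕ) : Commute (dirDeriv u) (dirDerivProd w a) := by
  refine Commute.list_prod_right _ _ fun x hx => ?_
  obtain ⟨i, rfl⟩ := (List.mem_ofFn' _ _).1 hx
  exact (commute_dirDeriv _ _).pow_right _

theorem MvPolynomial.IsHomogeneous.dirDerivProd {r d : ℕ} {g : MvPolynomial (Fin n) F}
    (hg : g.IsHomogeneous d) (w : Fin r → Fin n → F) (a : Fin r → ℕ) :
    (dirDerivProd w a g).IsHomogeneous (d - ∑ i, a i) := by
  induction r with
  | zero => simpa [_root_.dirDerivProd] using hg
  | succ r ih =>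
    rw [dirDerivProd_succ, Module.End.mul_apply, Fin.sum_univ_succ, add_comm (a 0), Nat.sub_add_eq]
    exact (ih (Fin.tail w) (Fin.tail a)).dirDeriv_pow _ _

theorem dirDeriv_mul_dirDerivProd {r : ℕ} (w : Fin r → Fin n → F) (a : Fin r → ℕ) (i : Fin r) :
    dirDeriv (w i) * dirDerivProd w a = dirDerivProd w (Pi.single i 1 + a) := by
  induction r with
  | zero => exact i.elim0
  | succ r ih =>
    rw [dirDerivProd_succ, dirDerivProd_succ]
    refine Fin.cases ?_ (fun i => ?_) i
    · have h : Fin.tail (Pi.single 0 1 + a) = Fin.tail a := by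
        ext j
        simp [Fin.tail]
      rw [h, ← mul_assoc, ← pow_succ']
      simp [add_comm]
    · have h : Fin.tail (Pi.single i.succ 1 + a) = Pi.single i 1 + Fin.tail a := by
        ext j
        simp [Fin.tail, Pi.single_apply]
      rw [h, ← ih (Fin.tail w), ← mul_assoc,
        ((commute_dirDeriv (w i.succ) (w 0)).pow_right (a 0)).eq, mul_assoc]
      simp [Fin.tail]

/-- The product of the derivatives in the directions `v (s j)` only depends on the number of
occurrences of each direction. -/
theorem prod_ofFn_dirDeriv_comp {r d : ℕ} (v : Fin r → Fin n → F) (s : Fin d → Fin r) :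
    (List.ofFn fun j => dirDeriv (v (s j))).prod = dirDerivProd v (∑ j, Pi.single (s j) 1) := by
  induction d with
  | zero =>
    have h : ∀ r : ℕ, (List.replicate r (1 : Module.End F (MvPolynomial (Fin n) F))).prod = 1 :=
      fun r => by simp
    simp [dirDerivProd, List.ofFn_const, h]
  | succ d ih =>
    rw [List.ofFn_succ, List.prod_cons, ih fun j => s j.succ, dirDeriv_mul_dirDerivProd,
      Fin.sum_univ_succ]

/-- Differentiating x^{m+e_k} along x_k produces the factor m_k + 1, which is what turns m! into (m
+ e_k)!. By commutativity the first direction can be applied innermost, which makes the induction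
run. -/
theorem coeff_zero_prod_ofFn_dirDeriv {d : ℕ} (y : Fin d → Fin n → F)
    (g : MvPolynomial (Fin n) F) :
    ((List.ofFn fun j => dirDeriv (y j)).prod g).coeff 0
      = ∑ a : Fin d → Fin n, g.coeff (∑ j, Finsupp.single (a j) 1)
          * ((∏ i, ((∑ j, Finsupp.single (a j) 1 : Fin n →₀ ℕ) i)! : ℕ) : F)
          * ∏ j, y j (a j) := by
  induction d generalizing g with
  | zero => simp
  | succ d ih =>
    have hcomm : Commute (dirDeriv (y 0)) (List.ofFn fun j : Fin d => dirDeriv (y j.succ)).prod := by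
      refine Commute.list_prod_right _ _ fun x hx => ?_
      obtain ⟨i, rfl⟩ := (List.mem_ofFn' _ _).1 hx
      exact commute_dirDeriv _ _
    rw [List.ofFn_succ, List.prod_cons, hcomm.eq, Module.End.mul_apply, ih fun j => y j.succ,
      ← (Fin.consEquiv fun _ => Fin n).sum_comp, Fintype.sum_prod_type, Finset.sum_comm]
    refine Finset.sum_congr rfl fun a _ => ?_
    simp only [coeff_dirDeriv, Finset.sum_mul, Fin.consEquiv_apply, Fin.sum_univ_succ,
      Fin.prod_univ_succ, Fin.cons_zero, Fin.cons_succ]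
    refine Finset.sum_congr rfl fun k _ => ?_
    set m : Fin n →₀ ℕ := ∑ j, Finsupp.single (a j) 1
    have hfac : ∏ i, ((Finsupp.single k 1 + m : Fin n →₀ ℕ) i)! = (m k + 1) * ∏ i, (m i)! := by
      rw [← Finset.mul_prod_erase _ _ (Finset.mem_univ k),
        ← Finset.mul_prod_erase _ (fun i => (m i)!) (Finset.mem_univ k), ← mul_assoc]
      congr 1
      · simp [add_comm 1, Nat.factorial_succ]
      · refine Finset.prod_congr rfl fun i hi => ?_
        simp [(Finset.ne_of_mem_erase hi).symm]
    rw [hfac, add_comm m]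
    push_cast
    ring

/-- The pairing of a form, regarded as a symmetric tensor, with a product tensor is the iterated
directional derivative. -/
theorem sum_polyTensor_mul_tensorProd [CharZero F] {d : ℕ} (g : MvPolynomial (Fin n) F)
    (y : Fin d → Fin n → F) :
    ∑ a, polyTensor d g a * tensorProd y a
      = ((List.ofFn fun j => dirDeriv (y j)).prod g).coeff 0 / d ! := by
  rw [coeff_zero_prod_ofFn_dirDeriv, Finset.sum_div]
  refine Finset.sum_congr rfl fun a _ => ?_
  simp only [polyTensor, tensorProd]
  ring

theorem sum_polyTensor_mul_tensorPow [CharZero F] {d : ℕ} {g : MvPolynomial (Fin n) F}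
    (hg : g.IsHomogeneous d) (x : Fin n → F) :
    ∑ a, polyTensor d g a * tensorPow d x a = MvPolynomial.eval x g := by
  rw [tensorPow, sum_polyTensor_mul_tensorProd, List.ofFn_const, List.prod_replicate,
    hg.coeff_zero_dirDeriv_pow,
    mul_div_cancel_left₀ _ (Nat.cast_ne_zero.2 (Nat.factorial_ne_zero d))]

end Field

variable [RCLike F]

theorem finrank_eq_finrank_map_add_finrank_inf_ker {K E E' : Type*} [Field K]
    [AddCommGroup E] [Module K E] [AddCommGroup E'] [Module K E'] (A : E →ₗ[K] E')
    (I : Submodule K E) [FiniteDimensional K I] :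
    Module.finrank K I
      = Module.finrank K (I.map A) + Module.finrank K (I ⊓ LinearMap.ker A : Submodule K E) := by
  rw [← LinearMap.finrank_range_add_finrank_ker (A.domRestrict I), LinearMap.range_domRestrict,
    LinearMap.ker_domRestrict, ← Submodule.map_comap_subtype, Submodule.finrank_map_subtype_eq]

/-- A space of forms of large dimension has, in suitable coordinates, elements with every
prescribed leading exponent in the first `r` coordinates. -/
theorem exists_directions_leading {d : ℕ} (r : ℕ) (I : Submodule F (MvPolynomial (Fin n) F))
    [FiniteDimensional F I] (hI : I ≤ MvPolynomial.homogeneousSubmodule (Fin n) F d)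
    (hdim : r * (n + (d - 1) - 1).choose (d - 1) < Module.finrank F I) :
    ∃ w : Fin r → Fin n → F, ∀ a : Fin r → ℕ, ∑ i, a i ≤ d →
      ∃ g ∈ I, dirDerivProd w a g ≠ 0 ∧
        ∀ b, Pi.Lex (· < ·) (fun {_} x y => x < y) a b → dirDerivProd w b g = 0 := by
  induction r generalizing I with
  | zero =>
    obtain ⟨g, hg, hg0⟩ := I.exists_mem_ne_zero_of_ne_bot (by
      rintro rfl
      simp at hdim)
    refine ⟨Fin.elim0, fun a _ => ⟨g, hg, by simpa [dirDerivProd] using hg0, ?_⟩⟩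
    rintro b ⟨i, _⟩
    exact i.elim0
  | succ r ih =>
    obtain ⟨w₀, hw₀⟩ := exists_direction_dirDeriv_mem I d
    -- The derivative along w₀ lands in degree d - 1, so the kernel in I keeps enough dimension for
    -- the r remaining directions.
    have hmap : Module.finrank F (I.map (dirDeriv w₀)) ≤ (n + (d - 1) - 1).choose (d - 1) := by
      have : Module.Finite F (MvPolynomial.homogeneousSubmodule (Fin n) F (d - 1)) :=
        Module.Finite.iff_fg.2 (MvPolynomial.homogeneousSubmodule_fg _ _ _)
      refine (Submodule.finrank_mono ?_).trans
        (MvPolynomial.finrank_homogeneousSubmodule_le n (d - 1) F)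
      rintro _ ⟨g, hg, rfl⟩
      exact (hI hg).dirDeriv w₀
    have hsum := finrank_eq_finrank_map_add_finrank_inf_ker (dirDeriv w₀) I
    obtain ⟨w, hw⟩ := ih (I ⊓ LinearMap.ker (dirDeriv w₀)) (inf_le_left.trans hI)
      (by rw [add_mul, one_mul] at hdim; omega)
    -- Repeated use of the choice of w₀ trades j derivatives of g along an arbitrary u for j
    -- derivatives along w₀ of another element of I whose next derivative still vanishes.
    have transport : ∀ g ∈ I ⊓ LinearMap.ker (dirDeriv w₀), ∀ u, ∀ j ≤ d, ∃ g' ∈ I,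
        (dirDeriv w₀ ^ (j + 1)) g' = 0 ∧ (dirDeriv w₀ ^ j) g' = (dirDeriv u ^ j) g := by
      intro g hg u j
      induction j with
      | zero => exact fun _ => ⟨g, hg.1, by simpa using hg.2, by simp⟩
      | succ j ihj =>
        intro hj
        obtain ⟨g₁, h1, h2, h3⟩ := ihj (by omega)
        obtain ⟨g₂, h4, h5⟩ := hw₀ j (by omega) g₁ h1 h2 u
        refine ⟨g₂, h4, ?_, ?_⟩
        · rw [pow_succ', Module.End.mul_apply, h5, ← Module.End.mul_apply (dirDeriv w₀),
            (commute_dirDeriv w₀ u).eq, Module.End.mul_apply, ← Module.End.mul_apply (dirDeriv w₀),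
            ← pow_succ', h2, map_zero]
        · rw [h5, h3, pow_succ', Module.End.mul_apply]
    refine ⟨Fin.cons w₀ w, fun a ha => ?_⟩
    rw [Fin.sum_univ_succ] at ha
    obtain ⟨g, hg, hg0, hglex⟩ := hw (Fin.tail a) (le_trans (Nat.le_add_left _ _) ha)
    -- The direction u may depend on a: it is only auxiliary, as `transport` converts it back to w₀.
    obtain ⟨u, hu⟩ := ((hI hg.1).dirDerivProd w (Fin.tail a)).exists_dirDeriv_pow_ne_zero
      hg0 (j := a 0) (by simp only [Fin.tail]; omega)
    obtain ⟨g', hg', h1, h2⟩ := transport g hg u (a 0) (by omega)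
    have key : ∀ b : Fin (r + 1) → ℕ, dirDerivProd (Fin.cons w₀ w : Fin (r + 1) → Fin n → F) b g'
        = dirDerivProd w (Fin.tail b) ((dirDeriv w₀ ^ b 0) g') := fun b => by
      rw [dirDerivProd_succ, Fin.cons_zero, Fin.tail_cons,
        ((commute_dirDeriv_dirDerivProd w₀ w (Fin.tail b)).pow_left (b 0)).eq,
        Module.End.mul_apply]
    have key' : ∀ b : Fin (r + 1) → ℕ, b 0 = a 0 →
        dirDerivProd (Fin.cons w₀ w : Fin (r + 1) → Fin n → F) b g'
        = (dirDeriv u ^ a 0) (dirDerivProd w (Fin.tail b) g) := fun b hb => by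
      rw [key, hb, h2, ← Module.End.mul_apply, ← Module.End.mul_apply,
        ((commute_dirDeriv_dirDerivProd u w (Fin.tail b)).pow_left (a 0)).eq]
    refine ⟨g', hg', by rwa [key' a rfl], fun b hab => ?_⟩
    rw [← Fin.cons_self_tail a, ← Fin.cons_self_tail b, Fin.pi_lex_lt_cons_cons] at hab
    -- A larger first exponent kills g' by the extra derivative along w₀; for equal first exponents
    -- the vanishing is inherited from g.
    rcases hab with hlt | ⟨heq, hlt⟩
    · obtain ⟨c, hc⟩ := Nat.exists_eq_add_of_le (Nat.succ_le_of_lt hlt)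
      rw [key, hc, add_comm _ c, pow_add, Module.End.mul_apply, Nat.succ_eq_add_one, h1, map_zero,
        map_zero]
    · rw [key' b heq.symm, hglex _ hlt, map_zero]

end IteratedDerivatives

/-! ### Polynomial functions and Zariski density -/

section PolynomialFunctions

variable {F : Type*}

/-- Two polynomials that do not vanish identically on `Y` have a common non-zero in `Y`. -/
def PolyIrreducible {σ : Type*} [Field F] (Y : Set (σ → F)) : Prop :=
  ∀ g h : MvPolynomial σ F, (∃ x ∈ Y, MvPolynomial.eval x g ≠ 0) →
    (∃ x ∈ Y, MvPolynomial.eval x h ≠ 0) →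
      ∃ x ∈ Y, MvPolynomial.eval x g ≠ 0 ∧ MvPolynomial.eval x h ≠ 0

variable [Field F]

theorem polyIrreducible_univ {σ : Type*} [Infinite F] :
    PolyIrreducible (Set.univ : Set (σ → F)) := by
  rintro g h ⟨x, -, hx⟩ ⟨y, -, hy⟩
  by_contra! hcon
  have : g * h = 0 := MvPolynomial.funext fun z => by
    by_cases hz : MvPolynomial.eval z g = 0
    · simp [hz]
    · simp [hcon z trivial hz]
  rcases mul_eq_zero.1 this with h0 | h0
  · simp [h0] at hx
  · simp [h0] at hy

theorem isOpen_zariski_eval_ne_zero {σ : Type*} (g : MvPolynomial σ F) :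
    IsOpen[zariskiTopology σ F] {x | MvPolynomial.eval x g ≠ 0} :=
  ⟨{g}, by ext x; simp [polyZeroSet]⟩

theorem exists_eq_polyZeroSet_of_isClosed {σ : Type*} {Z : Set (σ → F)}
    (h : IsClosed[zariskiTopology σ F] Z) : ∃ S, Z = polyZeroSet S := by
  obtain ⟨S, hS⟩ := h.isOpen_compl
  exact ⟨S, by rw [← hS, compl_compl]⟩

theorem exists_eval_ne_zero_of_notMem {σ : Type*} {Z : Set (σ → F)}
    (h : IsClosed[zariskiTopology σ F] Z) {x : σ → F} (hx : x ∉ Z) :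
    ∃ g, (∀ z ∈ Z, MvPolynomial.eval z g = 0) ∧ MvPolynomial.eval x g ≠ 0 := by
  obtain ⟨S, rfl⟩ := exists_eq_polyZeroSet_of_isClosed h
  simp only [polyZeroSet, Set.mem_ofPred_eq, not_forall] at hx
  obtain ⟨g, hg, hgx⟩ := hx
  exact ⟨g, fun z hz => hz g hg, hgx⟩

theorem PolyIrreducible.of_isIrreducible {σ : Type*} {Y : Set (σ → F)}
    (h : @IsIrreducible _ (zariskiTopology σ F) Y) : PolyIrreducible Y := fun p q hp hq =>
  h.2 _ _ (isOpen_zariski_eval_ne_zero p) (isOpen_zariski_eval_ne_zero q) hp hq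

theorem PolyIrreducible.exists_forall_ne_zero {σ ι : Type*} {Y : Set (σ → F)}
    (hY : PolyIrreducible Y) (hne : Y.Nonempty) (s : Finset ι) (g : ι → MvPolynomial σ F)
    (hg : ∀ i ∈ s, ∃ x ∈ Y, MvPolynomial.eval x (g i) ≠ 0) :
    ∃ x ∈ Y, ∀ i ∈ s, MvPolynomial.eval x (g i) ≠ 0 := by
  classical
  suffices h : ∃ x ∈ Y, MvPolynomial.eval x (∏ i ∈ s, g i) ≠ 0 by
    simpa [Finset.prod_ne_zero_iff] using h
  induction s using Finset.induction_on with
  | empty => simpa [Set.Nonempty] using hne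
  | insert i s hi ih =>
    rw [Finset.prod_insert hi]
    obtain ⟨x, hx, h1, h2⟩ := hY _ _ (hg i (Finset.mem_insert_self _ _))
      (ih fun j hj => hg j (Finset.mem_insert_of_mem hj))
    exact ⟨x, hx, by rw [map_mul]; exact mul_ne_zero h1 h2⟩

variable {R n : ℕ}

/-- The polynomial functions on the space of `R`-tuples of vectors. -/
noncomputable def tuplePolyFun (R n : ℕ) (F : Type*) [Field F] :
    Subalgebra F ((Fin R → Fin n → F) → F) :=
  (MvPolynomial.aeval (R := F)
    (fun (q : Fin R × Fin n) (v : Fin R → Fin n → F) => v q.1 q.2)).range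

theorem aeval_coord_apply (P : MvPolynomial (Fin R × Fin n) F) (v : Fin R → Fin n → F) :
    MvPolynomial.aeval (fun (q : Fin R × Fin n) (v : Fin R → Fin n → F) => v q.1 q.2) P v
      = MvPolynomial.eval (fun q => v q.1 q.2) P := by
  induction P using MvPolynomial.induction_on with
  | C a => simp
  | add p q hp hq => simp [hp, hq]
  | mul_X p i hp => simp [hp]

theorem mem_tuplePolyFun {Φ : (Fin R → Fin n → F) → F} :
    Φ ∈ tuplePolyFun R n F ↔ ∃ P : MvPolynomial (Fin R × Fin n) F,
      ∀ v, Φ v = MvPolynomial.eval (fun q => v q.1 q.2) P := by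
  constructor
  · rintro ⟨P, rfl⟩
    exact ⟨P, aeval_coord_apply P⟩
  · rintro ⟨P, hP⟩
    exact ⟨P, funext fun v => (aeval_coord_apply P v).trans (hP v).symm⟩

theorem coord_mem_tuplePolyFun (q : Fin R) (i : Fin n) :
    (fun v => v q i) ∈ tuplePolyFun R n F :=
  mem_tuplePolyFun.2 ⟨MvPolynomial.X (q, i), by simp⟩

theorem const_mem_tuplePolyFun (c : F) : (fun _ => c) ∈ tuplePolyFun R n F :=
  (tuplePolyFun R n F).algebraMap_mem c

theorem eval_comp_mem_tuplePolyFun (g : MvPolynomial (Fin n) F) (q : Fin R) :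
    (fun v => MvPolynomial.eval (v q) g) ∈ tuplePolyFun R n F := by
  refine mem_tuplePolyFun.2 ⟨MvPolynomial.rename (fun i => (q, i)) g, fun v => ?_⟩
  rw [MvPolynomial.eval_rename]
  rfl

theorem sum_mem_tuplePolyFun {ι : Type*} (s : Finset ι) {Φ : ι → (Fin R → Fin n → F) → F}
    (h : ∀ i ∈ s, Φ i ∈ tuplePolyFun R n F) :
    (fun v => ∑ i ∈ s, Φ i v) ∈ tuplePolyFun R n F := by
  have := (tuplePolyFun R n F).sum_mem h
  convert this using 1
  ext v
  simp

theorem prod_mem_tuplePolyFun {ι : Type*} (s : Finset ι) {Φ : ι → (Fin R → Fin n → F) → F}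
    (h : ∀ i ∈ s, Φ i ∈ tuplePolyFun R n F) :
    (fun v => ∏ i ∈ s, Φ i v) ∈ tuplePolyFun R n F := by
  have := (tuplePolyFun R n F).prod_mem h
  convert this using 1
  ext v
  simp

theorem det_mem_tuplePolyFun {ι : Type*} [Fintype ι] [DecidableEq ι]
    {M : (Fin R → Fin n → F) → Matrix ι ι F}
    (h : ∀ i j, (fun v => M v i j) ∈ tuplePolyFun R n F) :
    (fun v => (M v).det) ∈ tuplePolyFun R n F := by
  simp only [Matrix.det_apply']
  exact sum_mem_tuplePolyFun _ fun σ _ =>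
    mul_mem (const_mem_tuplePolyFun _) (prod_mem_tuplePolyFun _ fun i _ => h _ _)

/-- Injectivity of a matrix that depends polynomially on `v` is a Zariski open condition. -/
theorem exists_tuplePolyFun_mulVec_injective {ι κ : Type*} [Fintype ι] [Fintype κ]
    {M : (Fin R → Fin n → F) → Matrix ι κ F}
    (h : ∀ i j, (fun v => M v i j) ∈ tuplePolyFun R n F) {v₀ : Fin R → Fin n → F}
    (h₀ : Function.Injective (M v₀).mulVec) :
    ∃ H ∈ tuplePolyFun R n F, H v₀ ≠ 0 ∧ ∀ v, H v ≠ 0 → Function.Injective (M v).mulVec := by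
  classical
  -- With a fixed left inverse L of M(v₀), the determinant of L M(v) is the polynomial sought.
  obtain ⟨L, hL⟩ : ∃ L : Matrix κ ι F, L * M v₀ = 1 := by
    obtain ⟨g, hg⟩ := LinearMap.exists_leftInverse_of_injective (Matrix.toLin' (M v₀))
      (LinearMap.ker_eq_bot.2 h₀)
    refine ⟨LinearMap.toMatrix' g, ?_⟩
    have := congrArg LinearMap.toMatrix' hg
    rwa [LinearMap.toMatrix'_comp, LinearMap.toMatrix'_toLin', LinearMap.toMatrix'_id] at this
  refine ⟨fun v => (L * M v).det, ?_, by simp [hL], fun v hv => ?_⟩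
  · refine det_mem_tuplePolyFun fun i j => ?_
    simp only [Matrix.mul_apply]
    exact sum_mem_tuplePolyFun _ fun k _ => mul_mem (const_mem_tuplePolyFun _) (h _ _)
  · have hinj : Function.Injective (L * M v).mulVec :=
      Matrix.mulVec_injective_of_isUnit
        ((Matrix.isUnit_iff_isUnit_det _).2 (isUnit_iff_ne_zero.2 hv))
    intro x y hxy
    apply hinj
    rw [← Matrix.mulVec_mulVec, ← Matrix.mulVec_mulVec, hxy]

theorem exists_tuplePolyFun_linearIndependent {v₀ : Fin R → Fin n → F}
    (h₀ : LinearIndependent F v₀) :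
    ∃ H ∈ tuplePolyFun R n F, H v₀ ≠ 0 ∧ ∀ v, H v ≠ 0 → LinearIndependent F v := by
  obtain ⟨H, hH, h1, h2⟩ := exists_tuplePolyFun_mulVec_injective
    (M := fun v => (Matrix.of v)ᵀ) (v₀ := v₀) (fun i j => coord_mem_tuplePolyFun j i)
    (Matrix.mulVec_injective_iff.2 h₀)
  exact ⟨H, hH, h1, fun v hv => Matrix.mulVec_injective_iff.1 (h2 v hv)⟩

theorem coeff_dirDerivProd_mem_tuplePolyFun (b : Fin R → ℕ) (g : MvPolynomial (Fin n) F)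
    (m : Fin n →₀ ℕ) : (fun v => (dirDerivProd v b g).coeff m) ∈ tuplePolyFun R n F := by
  have step : ∀ (q : Fin R) (k : ℕ) (G : (Fin R → Fin n → F) → MvPolynomial (Fin n) F),
      (∀ m, (fun v => (G v).coeff m) ∈ tuplePolyFun R n F) →
      ∀ m, (fun v => ((dirDeriv (v q) ^ k) (G v)).coeff m) ∈ tuplePolyFun R n F := by
    intro q k G hG
    induction k with
    | zero => simpa using hG
    | succ k ih =>
      intro m
      simp only [pow_succ', Module.End.mul_apply, coeff_dirDeriv]
      exact sum_mem_tuplePolyFun _ fun i _ => mul_mem (coord_mem_tuplePolyFun q i)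
        (mul_mem (ih _) (const_mem_tuplePolyFun _))
  simp only [dirDerivProd, List.ofFn_eq_map]
  generalize List.finRange R = l
  induction l generalizing m with
  | nil => simpa using const_mem_tuplePolyFun _
  | cons q l ih =>
    simp only [List.map_cons, List.prod_cons, Module.End.mul_apply]
    exact step q (b q) _ ih m

theorem MvPolynomial.eval_aeval {σ τ : Type*} (f : σ → MvPolynomial τ F) (P : MvPolynomial σ F)
    (y : τ → F) : MvPolynomial.eval y (MvPolynomial.aeval f P)
      = MvPolynomial.eval (fun q => MvPolynomial.eval y (f q)) P := by
  induction P using MvPolynomial.induction_on with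
  | C a => simp
  | add p q hp hq => rw [map_add, map_add, map_add, hp, hq]
  | mul_X p i hp => rw [map_mul, map_mul, map_mul, hp, MvPolynomial.aeval_X, MvPolynomial.eval_X]

theorem MvPolynomial.polynomial_eval_aeval {σ : Type*} (f : σ → Polynomial F)
    (P : MvPolynomial σ F) (t : F) : (MvPolynomial.aeval f P).eval t
      = MvPolynomial.eval (fun q => (f q).eval t) P := by
  induction P using MvPolynomial.induction_on with
  | C a => simp
  | add p q hp hq => simp [hp, hq]
  | mul_X p i hp => simp [hp]

/-- If `Y` is irreducible, so is the set of the tuples whose entry at `z` lies in `Y`. -/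
theorem PolyIrreducible.exists_tuple_ne_zero [Infinite F] {Y : Set (Fin n → F)}
    (hY : PolyIrreducible Y) (z : Fin R) {Φ Ψ : (Fin R → Fin n → F) → F}
    (hΦ : Φ ∈ tuplePolyFun R n F) (hΨ : Ψ ∈ tuplePolyFun R n F)
    (h1 : ∃ v, v z ∈ Y ∧ Φ v ≠ 0) (h2 : ∃ v, v z ∈ Y ∧ Ψ v ≠ 0) :
    ∃ v, v z ∈ Y ∧ Φ v ≠ 0 ∧ Ψ v ≠ 0 := by
  obtain ⟨P, hP⟩ := mem_tuplePolyFun.1 hΦ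
  obtain ⟨Q, hQ⟩ := mem_tuplePolyFun.1 hΨ
  obtain ⟨v, hvY, hv⟩ := h1
  obtain ⟨w, hwY, hw⟩ := h2
  have slice : ∀ (v : Fin R → Fin n → F) (P : MvPolynomial (Fin R × Fin n) F),
      ∃ g : MvPolynomial (Fin n) F, ∀ y, MvPolynomial.eval y g
        = MvPolynomial.eval (fun q => Function.update v z y q.1 q.2) P := fun v P => by
    refine ⟨MvPolynomial.aeval (fun q : Fin R × Fin n =>
      if q.1 = z then MvPolynomial.X q.2 else MvPolynomial.C (v q.1 q.2)) P, fun y => ?_⟩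
    rw [MvPolynomial.eval_aeval]
    congr 2
    ext q
    by_cases hq : q.1 = z <;> simp [hq]
  obtain ⟨g, hg⟩ := slice v P
  obtain ⟨h, hh⟩ := slice w Q
  obtain ⟨y, hyY, hy1, hy2⟩ := hY g h
    ⟨v z, hvY, by rw [hg, Function.update_eq_self, ← hP]; exact hv⟩
    ⟨w z, hwY, by rw [hh, Function.update_eq_self, ← hQ]; exact hw⟩
  set a := Function.update v z y with ha
  set b := Function.update w z y with hb
  have haz : a z = y := by simp [ha]
  have hbz : b z = y := by simp [hb]
  -- The line from a (at t = 0) to b (at t = 1). Both have the entry y at z, so the whole line keeps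
  -- its entry at z in Y, and P and Q restrict to non-zero polynomials in t.
  set l : Fin R × Fin n → Polynomial F := fun q =>
    Polynomial.C (a q.1 q.2) + Polynomial.X * Polynomial.C (b q.1 q.2 - a q.1 q.2) with hl
  have hne : MvPolynomial.aeval l P * MvPolynomial.aeval l Q ≠ 0 := by
    refine mul_ne_zero (fun h0 => hy1 ?_) fun h0 => hy2 ?_
    · have := MvPolynomial.polynomial_eval_aeval l P 0
      rw [h0] at this
      rw [hg]
      simpa [hl] using this.symm
    · have := MvPolynomial.polynomial_eval_aeval l Q 1
      rw [h0] at this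
      rw [hh]
      simpa [hl] using this.symm
  obtain ⟨t, ht⟩ : ∃ t, (MvPolynomial.aeval l P * MvPolynomial.aeval l Q).eval t ≠ 0 := by
    by_contra! hcon
    exact hne (Polynomial.funext fun t => by simpa using hcon t)
  rw [Polynomial.eval_mul, MvPolynomial.polynomial_eval_aeval,
    MvPolynomial.polynomial_eval_aeval] at ht
  refine ⟨fun q i => (l (q, i)).eval t, ?_, ?_, ?_⟩
  · convert hyY using 1
    ext i
    simp [hl, haz, hbz]
  · rw [hP]
    exact left_ne_zero_of_mul ht
  · rw [hQ]
    exact right_ne_zero_of_mul ht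

/-- Every Zariski neighbourhood of a point contains a basic one, the non-vanishing locus of one
polynomial function, so density only has to be tested on those. -/
theorem isZariskiOpenDenseIn_of_tuplePolyFun {ι : Type*} (H : ι → (Fin R → Fin n → F) → F)
    (hH : ∀ i, H i ∈ tuplePolyFun R n F) (Y : Set (Fin R → Fin n → F))
    (hY : ∀ Ψ ∈ tuplePolyFun R n F, (∃ v ∈ Y, Ψ v ≠ 0) → ∃ v ∈ Y, Ψ v ≠ 0 ∧ ∃ i, H i v ≠ 0) :
    IsZariskiOpenDenseIn ({v | ∃ i, H i v ≠ 0} ∩ Y) Y := by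
  refine ⟨⟨{v | ∃ i, H i v ≠ 0}, ?_, rfl⟩, fun v hv => ?_⟩
  · rw [show {v | ∃ i, H i v ≠ 0} = ⋃ i, {v | H i v ≠ 0} by ext v; simp]
    refine @isOpen_iUnion _ _ (zariskiTopologyTuple R n F) _ fun i => ?_
    obtain ⟨P, hP⟩ := mem_tuplePolyFun.1 (hH i)
    refine ⟨_, isOpen_zariski_eval_ne_zero P, ?_⟩
    ext v
    simp [hP]
  · refine (@mem_closure_iff _ (zariskiTopologyTuple R n F) _ _).2 fun O hO hvO => ?_
    obtain ⟨O', hO', rfl⟩ := hO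
    obtain ⟨P, hP0, hPv⟩ := exists_eval_ne_zero_of_notMem
      (σ := Fin R × Fin n) (Z := O'ᶜ) (@IsOpen.isClosed_compl _ (zariskiTopology _ F) _ hO')
      (x := fun q => v q.1 q.2) (by simpa using hvO)
    have hmem : (fun w : Fin R → Fin n → F => MvPolynomial.eval (fun q => w q.1 q.2) P)
        ∈ tuplePolyFun R n F := mem_tuplePolyFun.2 ⟨P, fun w => rfl⟩
    obtain ⟨v', hv', h1, h2⟩ := hY _ hmem ⟨v, hv, hPv⟩
    refine ⟨v', ?_, h2, hv'⟩
    by_contra hcon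
    exact h1 (hP0 _ hcon)

end PolynomialFunctions

/-! ### The lifted intersection -/

section Lifted

/-- Equal multiplicities mean that the fibres of a and b over each index have the same size;
matching the fibres gives the permutation. -/
theorem exists_perm_of_sum_single_eq {ι : Type*} [DecidableEq ι] {d : ℕ} {a b : Fin d → ι}
    (h : ∑ j, Finsupp.single (a j) 1 = (∑ j, Finsupp.single (b j) 1 : ι →₀ ℕ)) :
    ∃ τ : Equiv.Perm (Fin d), b = a ∘ τ := by
  have hcard : ∀ (c : Fin d → ι) (i : ι), (∑ j, Finsupp.single (c j) 1 : ι →₀ ℕ) i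
      = Fintype.card {j // c j = i} := fun c i => by
    rw [Fintype.card_subtype, Finset.card_filter, Finsupp.finsetSum_apply]
    exact Finset.sum_congr rfl fun j _ => Finsupp.single_apply
  have e : ∀ i, {j // b j = i} ≃ {j // a j = i} := fun i =>
    Fintype.equivOfCardEq (by rw [← hcard, ← hcard, h])
  refine ⟨(Equiv.sigmaFiberEquiv b).symm.trans
    ((Equiv.sigmaCongrRight e).trans (Equiv.sigmaFiberEquiv a)), funext fun j => ?_⟩
  exact (e (b j) ⟨j, rfl⟩).2.symm

variable {F : Type*} {n : ℕ}

section Field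

variable [Field F]

/-- A symmetric tensor that is annihilated by all forms vanishes. -/
theorem eq_zero_of_mem_symTensors [CharZero F] {d : ℕ} {T : Tensor F n d}
    (hT : T ∈ symTensors F n d)
    (h : ∀ g : MvPolynomial (Fin n) F, g.IsHomogeneous d → ∑ a, polyTensor d g a * T a = 0) :
    T = 0 := by
  funext a₀
  have h1 := h (MvPolynomial.monomial (∑ j, Finsupp.single (a₀ j) 1) 1)
    (MvPolynomial.isHomogeneous_monomial _ (by simp))
  -- The monomial of a₀ is supported on rearrangements of a₀, where T is constant by symmetry. The
  -- pairing is thus a positive rational multiple of `T a₀`.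
  have h2 : ∀ a, polyTensor d (MvPolynomial.monomial (∑ j, Finsupp.single (a₀ j) 1) (1 : F)) a * T a
      = polyTensor d (MvPolynomial.monomial (∑ j, Finsupp.single (a₀ j) 1) (1 : F)) a * T a₀ := by
    intro a
    by_cases ha : ∑ j, Finsupp.single (a₀ j) 1 = (∑ j, Finsupp.single (a j) 1 : Fin n →₀ ℕ)
    · obtain ⟨τ, rfl⟩ := exists_perm_of_sum_single_eq ha
      rw [hT τ a₀]
    · simp [polyTensor, MvPolynomial.coeff_monomial, ha]
  have h3 : ∀ a, polyTensor d (MvPolynomial.monomial (∑ j, Finsupp.single (a₀ j) 1) (1 : F)) a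
      = ((if ∑ j, Finsupp.single (a₀ j) 1 = (∑ j, Finsupp.single (a j) 1 : Fin n →₀ ℕ) then
        ∏ i, ((∑ j, Finsupp.single (a j) 1 : Fin n →₀ ℕ) i)! else 0 : ℕ) : F) / d ! := by
    intro a
    simp only [polyTensor, MvPolynomial.coeff_monomial]
    split_ifs <;> simp
  rw [Finset.sum_congr rfl fun a _ => h2 a, ← Finset.sum_mul, mul_eq_zero] at h1
  refine h1.resolve_left ?_
  rw [Finset.sum_congr rfl fun a _ => h3 a, ← Finset.sum_div, ← Nat.cast_sum]
  refine div_ne_zero (Nat.cast_ne_zero.2 (Finset.sum_pos' (fun _ _ => Nat.zero_le _)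
    ⟨a₀, Finset.mem_univ _, ?_⟩).ne') (Nat.cast_ne_zero.2 (Nat.factorial_ne_zero d))
  rw [if_pos rfl]
  exact Finset.prod_pos fun i _ => Nat.factorial_pos _

theorem tensorPow_mem_symTensors (d : ℕ) (x : Fin n → F) : tensorPow d x ∈ symTensors F n d :=
  fun τ a => Equiv.prod_comp τ fun j => x (a j)

theorem tensorPow_mem_symPower {d : ℕ} {U : Submodule F (Fin n → F)} {x : Fin n → F}
    (hx : x ∈ U) : tensorPow d x ∈ symPower d U :=
  ⟨tensorPow_mem_symTensors d x, Submodule.subset_span ⟨fun _ => x, fun _ => hx, rfl⟩⟩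

theorem tensorPow_eq_zero {d : ℕ} {x : Fin n → F} (h : tensorPow d x = 0) : x = 0 := by
  funext i
  have := congrFun h fun _ => i
  simp only [tensorPow, tensorProd, Finset.prod_const, Pi.zero_apply] at this
  exact eq_zero_of_pow_eq_zero this

theorem exists_eq_sum_of_mem_symPower {R d : ℕ} {v : Fin R → Fin n → F} {T : Tensor F n d}
    (hT : T ∈ symPower d (Submodule.span F (Set.range v))) :
    ∃ c : (Fin d → Fin R) → F, T = ∑ s, c s • tensorProd fun j => v (s j) := by
  have h : T ∈ Submodule.span F (Set.range fun s : Fin d → Fin R => tensorProd fun j => v (s j)) := by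
    refine Submodule.span_le.2 ?_ hT.2
    rintro _ ⟨y, hy, rfl⟩
    choose c hc using fun j => (Submodule.mem_span_range_iff_exists_fun F).1 (hy j)
    have : tensorProd y = ∑ s : Fin d → Fin R, (∏ j, c j (s j)) • tensorProd fun j => v (s j) := by
      funext a
      simp only [tensorProd, ← hc, Finset.sum_apply, Pi.smul_apply, smul_eq_mul,
        Finset.prod_univ_sum, Fintype.piFinset_univ, ← Finset.prod_mul_distrib]
    rw [this]
    exact Submodule.sum_mem _ fun s _ => Submodule.smul_mem _ _ (Submodule.subset_span ⟨s, rfl⟩)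
  obtain ⟨c, hc⟩ := (Submodule.mem_span_range_iff_exists_fun F).1 h
  exact ⟨c, hc.symm⟩

theorem polyTensor_add (d : ℕ) (g h : MvPolynomial (Fin n) F) :
    polyTensor d (g + h) = polyTensor d g + polyTensor d h := by
  ext a
  simp [polyTensor, add_mul, add_div]

theorem polyTensor_smul (d : ℕ) (c : F) (g : MvPolynomial (Fin n) F) :
    polyTensor d (c • g) = c • polyTensor d g := by
  ext a
  simp [polyTensor, mul_assoc, mul_div_assoc]

theorem mem_formsPerp_iff {d p : ℕ} {f : Fin p → MvPolynomial (Fin n) F} {T : Tensor F n d} :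
    T ∈ formsPerp d f ↔ ∀ j, ∑ a, polyTensor d (f j) a * T a = 0 := by
  refine ⟨fun h j => h _ (Submodule.subset_span ⟨j, rfl⟩), fun h g hg => ?_⟩
  induction hg using Submodule.span_induction with
  | mem g hg =>
    obtain ⟨j, rfl⟩ := hg
    exact h j
  | zero => simp [polyTensor]
  | add g g' _ _ h1 h2 => simp [polyTensor_add, add_mul, Finset.sum_add_distrib, h1, h2]
  | smul c g _ h1 => simp [polyTensor_smul, mul_assoc, ← Finset.mul_sum, h1]

/-- The exponents of degree `d` in `R` variables. -/
def exponents (R d : ℕ) : Finset (Fin R → ℕ) := Finset.piAntidiag Finset.univ d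

theorem mem_exponents {R d : ℕ} {b : Fin R → ℕ} : b ∈ exponents R d ↔ ∑ i, b i = d := by
  simp [exponents]

/-- The pairing of forms with a tensor in `U^{⊗ d}` in terms of iterated derivatives. -/
theorem exists_pairing_eq_sum [CharZero F] {R d : ℕ} {v : Fin R → Fin n → F} {T : Tensor F n d}
    (hT : T ∈ symPower d (Submodule.span F (Set.range v))) :
    ∃ c : (Fin R → ℕ) → F, ∀ g : MvPolynomial (Fin n) F,
      ∑ a, polyTensor d g a * T a
        = ∑ b ∈ exponents R d, c b * (dirDerivProd v b g).coeff 0 := by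
  classical
  obtain ⟨c, rfl⟩ := exists_eq_sum_of_mem_symPower hT
  set type : (Fin d → Fin R) → Fin R → ℕ := fun s => ∑ j, Pi.single (s j) 1 with htype
  have hmem : ∀ s ∈ Finset.univ, type s ∈ exponents R d := fun s _ => by
    rw [mem_exponents]
    simp only [htype, Finset.sum_apply]
    rw [Finset.sum_comm]
    simp
  -- All words s in the vectors v with the same letter counts b give the same derivative, so their
  -- coefficients are added; the d! comes from the normalization of `polyTensor`.
  refine ⟨fun b => (∑ s with type s = b, c s) / d !, fun g => ?_⟩
  have h1 : ∑ a, polyTensor d g a * (∑ s, c s • tensorProd fun j => v (s j)) a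
      = ∑ s, c s / d ! * (dirDerivProd v (type s) g).coeff 0 := by
    simp only [Finset.sum_apply, Pi.smul_apply, smul_eq_mul, Finset.mul_sum]
    rw [Finset.sum_comm]
    refine Finset.sum_congr rfl fun s _ => ?_
    rw [div_mul_eq_mul_div, mul_div_assoc, htype, ← prod_ofFn_dirDeriv_comp,
      ← sum_polyTensor_mul_tensorProd, Finset.mul_sum]
    exact Finset.sum_congr rfl fun a _ => mul_left_comm _ _ _
  rw [h1, ← Finset.sum_fiberwise_of_maps_to hmem]
  refine Finset.sum_congr rfl fun b _ => ?_
  beta_reduce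
  rw [Finset.sum_div, Finset.sum_mul]
  refine Finset.sum_congr rfl fun s hs => ?_
  rw [(Finset.mem_filter.1 hs).2]

/-- The forms `f`, restricted to the span of `v`, separate the coordinates with exponents in `S`. -/
def SeparatesExponents {R p : ℕ} (f : Fin p → MvPolynomial (Fin n) F) (S : Finset (Fin R → ℕ))
    (v : Fin R → Fin n → F) : Prop :=
  ∀ c : (Fin R → ℕ) → F, (∀ j, ∑ b ∈ S, c b * (dirDerivProd v b (f j)).coeff 0 = 0) →
    ∀ b ∈ S, c b = 0

/-- The exponent `d` at the variable `z`. -/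
def pureExponent {R : ℕ} (z : Fin R) (d : ℕ) : Fin R → ℕ := Pi.single z d

theorem dirDerivProd_pureExponent {R : ℕ} (z : Fin R) (d : ℕ) (v : Fin R → Fin n → F) :
    dirDerivProd v (pureExponent z d) = dirDeriv (v z) ^ d := by
  have := prod_ofFn_dirDeriv_comp (d := d) v fun _ => z
  rw [List.ofFn_const, List.prod_replicate] at this
  rw [this]
  congr 1
  ext i
  simp [pureExponent, Pi.single_apply, Finset.sum_apply]

theorem liftedIntersection_eq_bot [CharZero F] {R p d : ℕ}
    {f : Fin p → MvPolynomial (Fin n) F} {v : Fin R → Fin n → F}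
    (h : SeparatesExponents f (exponents R d) v) : liftedIntersection d v f = ⊥ := by
  refine (Submodule.eq_bot_iff _).2 fun T hT => ?_
  obtain ⟨c, hc⟩ := exists_pairing_eq_sum hT.1
  have h0 := h c fun j => by rw [← hc]; exact mem_formsPerp_iff.1 hT.2 j
  refine eq_zero_of_mem_symTensors hT.1.1 fun g _ => ?_
  rw [hc]
  exact Finset.sum_eq_zero fun b hb => by rw [h0 b hb, zero_mul]

/-- The pure exponent contributes a multiple of f_j(v_z) = 0 to the equations, so it is
unconstrained, while separation makes all other coefficients vanish. What remains pairs with every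
form like a multiple of the d-th power of v_z. -/
theorem liftedIntersection_eq_span [CharZero F] {R p d : ℕ} (z : Fin R)
    {f : Fin p → MvPolynomial (Fin n) F} (hf : ∀ j, (f j).IsHomogeneous d)
    {v : Fin R → Fin n → F} (hv : v z ∈ polyZeroSet (Set.range f))
    (h : SeparatesExponents f ((exponents R d).erase (pureExponent z d)) v) :
    liftedIntersection d v f = Submodule.span F {tensorPow d (v z)} := by
  have hz : pureExponent z d ∈ exponents R d := mem_exponents.2 (by simp [pureExponent])
  have hzero : ∀ j, MvPolynomial.eval (v z) (f j) = 0 := fun j => hv _ ⟨j, rfl⟩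
  refine le_antisymm (fun T hT => ?_) ?_
  · obtain ⟨c, hc⟩ := exists_pairing_eq_sum hT.1
    have h0 := h c fun j => by
      have h1 := mem_formsPerp_iff.1 hT.2 j
      rwa [hc, ← Finset.add_sum_erase _ _ hz, dirDerivProd_pureExponent,
        (hf j).coeff_zero_dirDeriv_pow, hzero j, mul_zero, mul_zero, zero_add] at h1
    refine Submodule.mem_span_singleton.2 ⟨c (pureExponent z d) * d !, ?_⟩
    refine (sub_eq_zero.1 (eq_zero_of_mem_symTensors (Submodule.sub_mem _ hT.1.1
      (Submodule.smul_mem _ _ (tensorPow_mem_symTensors d (v z)))) fun g hg => ?_)).symm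
    simp only [Pi.sub_apply, Pi.smul_apply, mul_sub, Finset.sum_sub_distrib, smul_eq_mul,
      mul_left_comm _ (c (pureExponent z d) * (d ! : F)), ← Finset.mul_sum]
    rw [hc, sum_polyTensor_mul_tensorPow hg, ← Finset.add_sum_erase _ _ hz,
      dirDerivProd_pureExponent, hg.coeff_zero_dirDeriv_pow, mul_assoc, add_sub_cancel_left]
    exact Finset.sum_eq_zero fun b hb => by rw [h0 b hb, zero_mul]
  · rw [Submodule.span_singleton_le_iff_mem]
    refine ⟨tensorPow_mem_symPower (Submodule.subset_span ⟨z, rfl⟩), mem_formsPerp_iff.2 fun j => ?_⟩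
    rw [sum_polyTensor_mul_tensorPow (hf j), hzero j]

theorem exists_tuplePolyFun_separatesExponents {R p : ℕ} {f : Fin p → MvPolynomial (Fin n) F}
    {S : Finset (Fin R → ℕ)} {v₀ : Fin R → Fin n → F} (h₀ : SeparatesExponents f S v₀) :
    ∃ H ∈ tuplePolyFun R n F, H v₀ ≠ 0 ∧ ∀ v, H v ≠ 0 → SeparatesExponents f S v := by
  set M : (Fin R → Fin n → F) → Matrix (Fin p) S F := fun v =>
    Matrix.of fun j b => (dirDerivProd v b (f j)).coeff 0 with hM
  have hsep : ∀ v, SeparatesExponents f S v ↔ Function.Injective (M v).mulVec := by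
    intro v
    have hsum : ∀ (c : (Fin R → ℕ) → F) j,
        (M v *ᵥ fun b => c b) j = ∑ b ∈ S, c b * (dirDerivProd v b (f j)).coeff 0 := by
      intro c j
      rw [← Finset.sum_coe_sort]
      exact Finset.sum_congr rfl fun b _ => mul_comm _ _
    rw [← Matrix.coe_mulVecLin, ← LinearMap.ker_eq_bot, LinearMap.ker_eq_bot']
    classical
    constructor
    · intro h c hc
      have := h (fun b => if hb : b ∈ S then c ⟨b, hb⟩ else 0) fun j => by
        rw [← hsum]
        simpa using congrFun hc j
      funext b
      simpa using this b b.2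
    · intro h c hc b hb
      have := h (fun b => c b) (funext fun j => (hsum c j).trans (hc j))
      exact congrFun this ⟨b, hb⟩
  obtain ⟨H, hH, h1, h2⟩ := exists_tuplePolyFun_mulVec_injective (M := M)
    (fun j b => coeff_dirDerivProd_mem_tuplePolyFun _ _ _) ((hsep v₀).1 h₀)
  exact ⟨H, hH, h1, fun v hv => (hsep v).2 (h2 v hv)⟩

end Field

variable [RCLike F]

/-- If there are enough forms, some tuple with first entry in `Y` separates all exponents `b`
such that no form of degree `b 0` vanishes on `Y`. -/
theorem exists_separatesExponents {d r p : ℕ} {f : Fin p → MvPolynomial (Fin n) F}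
    (hf : ∀ j, (f j).IsHomogeneous d) (hindep : LinearIndependent F f)
    (hdim : r * (n + (d - 1) - 1).choose (d - 1) < p)
    {Y : Set (Fin n → F)} (hY : PolyIrreducible Y) (hne : Y.Nonempty)
    {S : Finset (Fin (r + 1) → ℕ)} (hS : ∀ b ∈ S, ∑ i, b i = d)
    (hYS : ∀ b ∈ S, ∀ g : MvPolynomial (Fin n) F, g.IsHomogeneous (b 0) → g ≠ 0 →
      ∃ x ∈ Y, MvPolynomial.eval x g ≠ 0) :
    ∃ v : Fin (r + 1) → Fin n → F, v 0 ∈ Y ∧ SeparatesExponents f S v := by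
  set I := Submodule.span F (Set.range f) with hIdef
  have : FiniteDimensional F I := FiniteDimensional.span_of_finite F (Set.finite_range f)
  have hI : I ≤ MvPolynomial.homogeneousSubmodule (Fin n) F d :=
    Submodule.span_le.2 (by rintro _ ⟨j, rfl⟩; exact hf j)
  obtain ⟨w, hw⟩ := exists_directions_leading r I hI
    (by rw [hIdef, finrank_span_eq_card hindep, Fintype.card_fin]; exact hdim)
  have hdeg : ∀ b ∈ S, b 0 + ∑ i, Fin.tail b i = d := fun b hb => by
    rw [← hS b hb, Fin.sum_univ_succ]
    rfl
  have hex : ∀ b : Fin (r + 1) → ℕ, ∃ g : MvPolynomial (Fin n) F, b ∈ S → g ∈ I ∧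
      dirDerivProd w (Fin.tail b) g ≠ 0 ∧ ∀ b', Pi.Lex (· < ·) (fun {_} x y => x < y)
        (Fin.tail b) b' → dirDerivProd w b' g = 0 := by
    intro b
    by_cases hb : b ∈ S
    · obtain ⟨g, hg⟩ := hw (Fin.tail b) (by rw [← hdeg b hb]; exact Nat.le_add_left _ _)
      exact ⟨g, fun _ => hg⟩
    · exact ⟨0, fun h => absurd h hb⟩
  choose g hg using hex
  have hhom : ∀ (a : Fin (r + 1) → ℕ) (q : MvPolynomial (Fin n) F), a ∈ S → q ∈ I →
      (dirDerivProd w (Fin.tail a) q).IsHomogeneous (a 0) := fun a q ha hq => by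
    have := (hI hq).dirDerivProd w (Fin.tail a)
    rwa [← hdeg a ha, Nat.add_sub_cancel] at this
  -- One point of Y avoids the zero sets of all leading derivatives at once; the one of b has degree
  -- `b 0`.
  obtain ⟨x, hxY, hx⟩ := hY.exists_forall_ne_zero hne S
    (fun b => dirDerivProd w (Fin.tail b) (g b)) fun b hb =>
      hYS b hb _ (hhom b _ hb (hg b hb).1) (hg b hb).2.1
  refine ⟨Fin.cons x w, hxY, fun c hc => ?_⟩
  have hcI : ∀ q ∈ I, ∑ b ∈ S, c b *
      (dirDerivProd (Fin.cons x w : Fin (r + 1) → Fin n → F) b q).coeff 0 = 0 := by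
    intro q hq
    induction hq using Submodule.span_induction with
    | mem q hq =>
      obtain ⟨j, rfl⟩ := hq
      exact hc j
    | zero => simp
    | add q q' _ _ h1 h2 => simp [mul_add, Finset.sum_add_distrib, h1, h2]
    | smul t q _ h1 => simp [mul_left_comm, ← Finset.mul_sum, h1]
  have hcoeff : ∀ b ∈ S, ∀ q ∈ I,
      (dirDerivProd (Fin.cons x w : Fin (r + 1) → Fin n → F) b q).coeff 0
        = (b 0)! * MvPolynomial.eval x (dirDerivProd w (Fin.tail b) q) := fun b hb q hq => by
    rw [dirDerivProd_succ, Fin.cons_zero, Fin.tail_cons, Module.End.mul_apply,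
      (hhom b q hb hq).coeff_zero_dirDeriv_pow]
  by_contra! hcon
  obtain ⟨b₀, hb₀, hcb₀⟩ := hcon
  -- Triangularity: with a lexicographically minimal tail, testing the relation on `g b` kills every
  -- other term. Equal tails do not matter, because the total degree d then determines the first
  -- exponent.
  obtain ⟨b, hb, hmin⟩ := (S.filter fun b => c b ≠ 0).exists_min_image
    (fun b => toLex (Fin.tail b)) ⟨b₀, Finset.mem_filter.2 ⟨hb₀, hcb₀⟩⟩
  obtain ⟨hbS, hcb⟩ := Finset.mem_filter.1 hb
  have hsum := hcI (g b) (hg b hbS).1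
  rw [Finset.sum_eq_single_of_mem b hbS, hcoeff b hbS _ (hg b hbS).1] at hsum
  · exact mul_ne_zero hcb (mul_ne_zero (Nat.cast_ne_zero.2 (Nat.factorial_ne_zero _))
      (hx b hbS)) hsum
  · intro b' hb' hne'
    by_cases hcb' : c b' = 0
    · rw [hcb', zero_mul]
    have hle := hmin b' (Finset.mem_filter.2 ⟨hb', hcb'⟩)
    rcases hle.lt_or_eq with hlt | heq
    · rw [hcoeff b' hb' _ (hg b hbS).1, (hg b hbS).2.2 (Fin.tail b') hlt]
      simp
    · refine absurd ?_ hne'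
      have ht : Fin.tail b = Fin.tail b' := toLex.injective heq
      have h0 : b' 0 = b 0 := by
        have h1 := hdeg b hbS
        have h2 := hdeg b' hb'
        rw [ht] at h1
        omega
      rw [← Fin.cons_self_tail b, ← Fin.cons_self_tail b', ht, h0]

end Lifted

/-! ### Analysis of the algorithms -/

section Algorithm

variable {F : Type*} [RCLike F]

theorem isPenroseInverse_pinv {ι κ : Type*} [Fintype ι] [Fintype κ] (A : Matrix ι κ F) :
    IsPenroseInverse A (pinv A) :=
  (exists_isPenroseInverse A).choose_spec

/-! ### Spectra of rank-one matrices -/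

section RankOne

variable {ι : Type*} [Fintype ι] {x l : ι → F} {lam : F}

theorem vecMulVec_mulVec_eq_smul (x l y : ι → F) :
    Matrix.vecMulVec x l *ᵥ y = (l ⬝ᵥ y) • x := by
  rw [Matrix.vecMulVec_mulVec, op_smul_eq_smul]

theorem rank_vecMulVec_of_eigenvector (hx : x ≠ 0) (hlam : lam ≠ 0)
    (h : Matrix.vecMulVec x l *ᵥ x = lam • x) : (Matrix.vecMulVec x l).rank = 1 := by
  refine le_antisymm (Matrix.rank_vecMulVec_le x l) (Nat.one_le_iff_ne_zero.2 fun h0 => ?_)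
  have h1 : LinearMap.range (Matrix.vecMulVec x l).mulVecLin = ⊥ := Submodule.finrank_eq_zero.1 h0
  have h2 : (Matrix.vecMulVec x l).mulVecLin x = 0 := by
    rw [LinearMap.range_eq_bot.1 h1, LinearMap.zero_apply]
  rw [Matrix.mulVecLin_apply, h] at h2
  exact smul_ne_zero hlam hx h2

theorem eq_smul_of_vecMulVec_eigenvector {y : ι → F} {mu : F} (hy : y ≠ 0) (hmu : mu ≠ 0)
    (h : Matrix.vecMulVec x l *ᵥ y = mu • y) : ∃ c : F, c ≠ 0 ∧ y = c • x := by
  rw [vecMulVec_mulVec_eq_smul] at h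
  have hyx : y = (mu⁻¹ * (l ⬝ᵥ y)) • x := by
    rw [mul_smul, h, inv_smul_smul₀ hmu]
  refine ⟨_, fun h0 => hy ?_, hyx⟩
  rw [hyx, h0, zero_smul]

theorem nonzeroEigenvalues_vecMulVec (hx : x ≠ 0) (hlam : lam ≠ 0)
    (h : Matrix.vecMulVec x l *ᵥ x = lam • x) :
    nonzeroEigenvalues (Matrix.vecMulVec x l) = {lam} := by
  ext mu
  constructor
  · rintro ⟨hmu, y, hy, hyeq⟩
    obtain ⟨c, hc, rfl⟩ := eq_smul_of_vecMulVec_eigenvector hy hmu hyeq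
    rw [Matrix.mulVec_smul, h, smul_comm] at hyeq
    exact (smul_left_injective F hy hyeq).symm
  · rintro rfl
    exact ⟨hlam, x, hx, h⟩

theorem mulVec_eq_smul_of_mul_vecMulVec {κ : Type*} {M : Matrix ι ι F} {a : ι → F} {b : κ → F}
    {q : F} (hb : b ≠ 0) (h : M * Matrix.vecMulVec a b = q • Matrix.vecMulVec a b) :
    M *ᵥ a = q • a := by
  obtain ⟨k, hk⟩ := Function.ne_iff.1 hb
  rw [Matrix.mul_vecMulVec, ← Matrix.smul_vecMulVec] at h
  exact funext fun i => mul_right_cancel₀ hk (congrFun (congrFun h i) k)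

end RankOne

/-! ### Simultaneous diagonalization: termination and the rank-one case -/

section SimDiag

variable {ι₁ ι₂ ι₃ : Type*} [Fintype ι₁] [Fintype ι₂] [Fintype ι₃]

/-- Independence of the y_a is enough: tensor the functional dual to y_a with a coordinate
functional normalized to 1 at z_a. -/
theorem exists_areDual {r : ℕ} {y : Fin r → ι₂ → F} {z : Fin r → ι₃ → F}
    (hy : LinearIndependent F y) (hz : ∀ a, z a ≠ 0) : ∃ h, AreDual y z h := by
  classical
  obtain ⟨L, hL⟩ := LinearMap.exists_leftInverse_of_injective (Fintype.linearCombination F y)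
    (LinearMap.ker_eq_bot.2 (linearIndependent_iff_injective_fintypeLinearCombination.1 hy))
  have hLy : ∀ a, L (y a) = Pi.single a 1 := fun a => by
    have := LinearMap.congr_fun hL (Pi.single a 1)
    simpa [Fintype.linearCombination_apply_single] using this
  choose c hc using fun a => Function.ne_iff.1 (hz a)
  refine ⟨fun a b k => L (Pi.single b 1) a * if k = c a then (z a (c a))⁻¹ else 0,
    fun a a' => ?_⟩
  have hsum : ∑ b, L (Pi.single b 1) a * y a' b = (Pi.single a' 1 : Fin r → F) a := by
    rw [← hLy a']
    conv_rhs => rw [pi_eq_sum_univ' (y a')]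
    simp [map_sum, mul_comm]
  calc _ = ∑ b, (L (Pi.single b 1) a * y a' b) * ((z a (c a))⁻¹ * z a' (c a)) := by
        refine Finset.sum_congr rfl fun b _ => ?_
        rw [Finset.sum_eq_single (c a) (fun k _ hk => by simp [hk]) (by simp)]
        beta_reduce
        rw [if_pos rfl]
        ring
    _ = _ := by
        rw [← Finset.sum_mul, hsum]
        by_cases h : a = a'
        · subst h
          simpa using inv_mul_cancel₀ (hc a)
        · simp [h]

/-- The simultaneous diagonalization algorithm always terminates. -/
theorem exists_simDiagRun (T : ι₁ → Matrix ι₂ ι₃ F) (η θ : ι₁ → F) :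
    ∃ o, SimDiagRun T η θ o := by
  by_cases h : ∃ (r : ℕ) (lam : Fin r → F), IsSimpleSpectrum (simDiagLeft T η θ) lam
  swap
  · exact ⟨_, .fail_left h⟩
  obtain ⟨r, lam, hlam⟩ := h
  by_cases hright : nonzeroEigenvalues (simDiagRight T η θ) = Set.range (fun a => (lam a)⁻¹)
  swap
  · exact ⟨_, .fail_right lam hlam hright⟩
  have h1 : ∀ a, lam a ∈ nonzeroEigenvalues (simDiagLeft T η θ) := fun a => by
    rw [← hlam.2.2]
    exact ⟨a, rfl⟩
  have h2 : ∀ a, (lam a)⁻¹ ∈ nonzeroEigenvalues (simDiagRight T η θ) := fun a => by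
    rw [hright]
    exact ⟨a, rfl⟩
  choose y hy using fun a => (h1 a).2
  choose z hz using fun a => (h2 a).2
  have hli : LinearIndependent F y :=
    Module.End.eigenvectors_linearIndependent' (simDiagLeft T η θ).mulVecLin lam hlam.2.1 y
      fun a => Module.End.hasEigenvector_iff.2
        ⟨Module.End.mem_eigenspace_iff.2 (hy a).2, (hy a).1⟩
  obtain ⟨h, hh⟩ := exists_areDual hli fun a => (hz a).1
  by_cases hpar : ∃ a b, a ≠ b ∧ contractPair T (h a) ∈ Submodule.span F {contractPair T (h b)}
  · exact ⟨_, .fail_parallel lam y z h hlam hright hy hz hh hpar⟩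
  · exact ⟨_, .success lam y z h hlam hright hy hz hh hpar⟩

/-- On a tensor whose contractions are multiples of one matrix `x zᵀ`, the simultaneous
diagonalization algorithm outputs one product tensor with factors proportional to `x` and `z`. -/
theorem SimDiagRun.of_contract_eq_smul {T : ι₁ → Matrix ι₂ ι₃ F} {η θ : ι₁ → F} {s t : F}
    {x : ι₂ → F} {z : ι₃ → F} (hη : contract T η = s • Matrix.vecMulVec x z)
    (hθ : contract T θ = t • Matrix.vecMulVec x z) (hs : s ≠ 0) (ht : t ≠ 0) (hx : x ≠ 0)
    (hz : z ≠ 0) {o : SimDiagOutput F ι₁ ι₂ ι₃} (ho : SimDiagRun T η θ o) :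
    ∃ (α β : F) (h : ι₂ → ι₃ → F), α ≠ 0 ∧ β ≠ 0 ∧
      ∑ b, ∑ c, h b c * ((α * x b) * (β * z c)) = 1 ∧
      o = .decomposition 1 (fun _ => contractPair T h) (fun _ => α • x) (fun _ => β • z) := by
  set A := Matrix.vecMulVec x z with hA
  have hleft : simDiagLeft T η θ = Matrix.vecMulVec x (s • (z ᵥ* pinv (t • A))) := by
    rw [simDiagLeft, hη, hθ, hA, Matrix.smul_mul, Matrix.vecMulVec_mul, Matrix.vecMulVec_smul]
  have hright : simDiagRight T η θ = Matrix.vecMulVec z (t • (x ᵥ* (pinv (s • A))ᵀ)) := by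
    rw [simDiagRight, hη, hθ, hA, Matrix.transpose_mul, Matrix.transpose_smul,
      Matrix.transpose_vecMulVec, Matrix.smul_mul, Matrix.vecMulVec_mul, Matrix.vecMulVec_smul]
  -- The Penrose identity A A⁺ A = A alone gives the eigenvalue; no explicit pseudoinverse is
  -- required.
  have hleft_eig : simDiagLeft T η θ *ᵥ x = (s / t) • x := by
    refine mulVec_eq_smul_of_mul_vecMulVec hz ?_
    have h1 := (isPenroseInverse_pinv (t • A)).left
    rw [simDiagLeft, hη, hθ, ← hA]
    calc s • A * pinv (t • A) * A = (s / t ^ 2) • (t • A * pinv (t • A) * (t • A)) := by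
          simp only [Matrix.smul_mul, Matrix.mul_smul, smul_smul]
          congr 1
          field_simp
      _ = (s / t) • A := by
          rw [h1, smul_smul]
          congr 1
          field_simp
  have hright_eig : simDiagRight T η θ *ᵥ z = (s / t)⁻¹ • z := by
    refine mulVec_eq_smul_of_mul_vecMulVec hx ?_
    have h1 := congrArg Matrix.transpose (isPenroseInverse_pinv (s • A)).left
    rw [simDiagRight, hη, hθ, ← Matrix.transpose_vecMulVec, ← hA, ← Matrix.transpose_mul,
      ← Matrix.transpose_smul]
    congr 1
    rw [Matrix.transpose_inj] at h1
    calc A * (pinv (s • A) * t • A) = (t / s ^ 2) • (s • A * pinv (s • A) * (s • A)) := by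
          simp only [Matrix.smul_mul, Matrix.mul_smul, smul_smul, Matrix.mul_assoc]
          congr 1
          field_simp
      _ = (s / t)⁻¹ • A := by
          rw [h1, smul_smul]
          congr 1
          field_simp
  have hst : s / t ≠ 0 := div_ne_zero hs ht
  rw [hleft] at hleft_eig
  rw [hright] at hright_eig
  have hspecL := nonzeroEigenvalues_vecMulVec hx hst hleft_eig
  have hspecR := nonzeroEigenvalues_vecMulVec hz (inv_ne_zero hst) hright_eig
  have hrank := rank_vecMulVec_of_eigenvector hx hst hleft_eig
  rw [← hleft] at hspecL hrank
  rw [← hright] at hspecR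
  -- The rank is one, so there is a single index, and the failure by parallel vectors, which needs
  -- two, cannot occur.
  have hr : ∀ {r : ℕ} {lam : Fin r → F}, IsSimpleSpectrum (simDiagLeft T η θ) lam →
      r = 1 ∧ ∀ a, lam a = s / t := by
    intro r lam hlam
    refine ⟨hlam.1.trans hrank, fun a => ?_⟩
    have : lam a ∈ nonzeroEigenvalues (simDiagLeft T η θ) := hlam.2.2 ▸ Set.mem_range_self a
    rwa [hspecL] at this
  cases ho with
  | fail_left h =>
    refine absurd ⟨1, fun _ => s / t, hrank.symm, fun a b _ => Subsingleton.elim a b, ?_⟩ h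
    rw [hspecL, Set.range_const]
  | fail_right lam hlam h =>
    obtain ⟨rfl, hl⟩ := hr hlam
    refine absurd ?_ h
    rw [hspecR]
    simp [hl]
  | fail_parallel lam y z' h hlam _ _ _ _ hpar =>
    obtain ⟨rfl, hl⟩ := hr hlam
    obtain ⟨a, b, hab, -⟩ := hpar
    exact absurd (Subsingleton.elim a b) hab
  | success lam y z' h hlam _ hy hz' hh hpar =>
    obtain ⟨rfl, hl⟩ := hr hlam
    rw [hleft] at hy
    rw [hright] at hz'
    obtain ⟨α, hα, hyα⟩ := eq_smul_of_vecMulVec_eigenvector (hy 0).1 (by rw [hl]; exact hst)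
      (hy 0).2
    obtain ⟨β, hβ, hzβ⟩ := eq_smul_of_vecMulVec_eigenvector (hz' 0).1
      (inv_ne_zero (by rw [hl]; exact hst)) (hz' 0).2
    have hdual := hh 0 0
    rw [hyα, hzβ] at hdual
    refine ⟨α, β, h 0, hα, hβ, by simpa using hdual, ?_⟩
    congr 1
    · funext a
      rw [Subsingleton.elim a 0]
    · funext a
      rw [Subsingleton.elim a 0, hyα]
    · funext a
      rw [Subsingleton.elim a 0, hzβ]

end SimDiag

/-! ### The intersection algorithm on one variety -/

section Intersect

variable {n R p : ℕ}

theorem exists_intersectRun (d : ℕ) (u : Fin R → Fin n → F)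
    (f : Fin p → MvPolynomial (Fin n) F) {s : ℕ}
    (P : Module.Basis (Fin s) F (liftedIntersection d u f)) (η θ : Fin s → F) :
    ∃ o, IntersectRun d u f P η θ o := by
  by_cases h : liftedIntersection d u f = ⊥
  · exact ⟨_, .trivial h⟩
  rcases lt_or_ge R s with hs | hs
  · exact ⟨_, .fail_size h hs⟩
  obtain ⟨o, ho⟩ := exists_simDiagRun (sliceTensor fun i => (P i : Tensor F n d)) η θ
  by_cases hx : ∃ c x, IsPowerDecomposition (fun i => (P i : Tensor F n d)) o c x
  · obtain ⟨c, x, hx⟩ := hx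
    exact ⟨_, .only h hs o ho c x hx⟩
  · exact ⟨_, .fail_decomposition h hs o ho hx⟩

theorem IntersectRun.eq_trivial {d : ℕ} {u : Fin R → Fin n → F}
    {f : Fin p → MvPolynomial (Fin n) F} {s : ℕ}
    {P : Module.Basis (Fin s) F (liftedIntersection d u f)} {η θ : Fin s → F}
    {o : IntersectOutput F n} (ho : IntersectRun d u f P η θ o)
    (h : liftedIntersection d u f = ⊥) : o = .trivial := by
  cases ho with
  | trivial _ => rfl
  | fail_size h' => exact absurd h h'
  | only h' => exact absurd h h'
  | fail_decomposition h' => exact absurd h h'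

theorem tensorPow_consIndex {d : ℕ} (hd : 0 < d) (x : Fin n → F) (a : Fin n)
    (b : Fin (d - 1) → Fin n) :
    tensorPow d x (consIndex a b) = x a * tensorPow (d - 1) x b := by
  obtain ⟨d, rfl⟩ := Nat.exists_eq_succ_of_ne_zero hd.ne'
  simp only [tensorPow, tensorProd, Fin.prod_univ_succ]
  rfl

/-- Fix k with y_k ≠ 0 and compare the entries in which all indices but the first equal k. -/
theorem eq_smul_of_tensorPow_eq_smul {d : ℕ} (hd : 0 < d) {x y : Fin n → F} (hy : y ≠ 0) {q : F}
    (h : tensorPow d y = q • tensorPow d x) : ∃ c : F, c ≠ 0 ∧ y = c • x := by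
  obtain ⟨k, hk⟩ := Function.ne_iff.1 hy
  have h1 : ∀ a, y a * y k ^ (d - 1) = q * (x a * x k ^ (d - 1)) := fun a => by
    have := congrFun h (consIndex a fun _ => k)
    rw [Pi.smul_apply, tensorPow_consIndex hd, tensorPow_consIndex hd] at this
    simpa [tensorPow, tensorProd] using this
  have hk' : y k ^ (d - 1) ≠ 0 := pow_ne_zero _ hk
  have hyx : y = (q * x k ^ (d - 1) / y k ^ (d - 1)) • x := by
    funext a
    rw [Pi.smul_apply, smul_eq_mul, div_mul_eq_mul_div, eq_div_iff hk', h1]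
    ring
  refine ⟨_, fun h0 => hy ?_, hyx⟩
  rw [hyx, h0, zero_smul]

/-- If `S^d(U) ∩ I_d^⊥` is spanned by `x^{⊗ d}`, the intersection algorithm reports a multiple
of `x`, unless it draws the zero functional. -/
theorem IntersectRun.exists_smul_mem_reported {d : ℕ} (hd : 0 < d) (hR : 0 < R)
    {u : Fin R → Fin n → F} {f : Fin p → MvPolynomial (Fin n) F} {s : ℕ}
    {P : Module.Basis (Fin s) F (liftedIntersection d u f)} {η θ : Fin s → F} (hη : η ≠ 0)
    (hθ : θ ≠ 0) {x : Fin n → F} (hx : x ≠ 0)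
    (h : liftedIntersection d u f = Submodule.span F {tensorPow d x})
    {o : IntersectOutput F n} (ho : IntersectRun d u f P η θ o) :
    ∃ c : F, c ≠ 0 ∧ c • x ∈ o.reported := by
  have hpow : tensorPow d x ≠ 0 := fun h0 => hx (tensorPow_eq_zero h0)
  have hbot : liftedIntersection d u f ≠ ⊥ := by
    rw [h, Ne, Submodule.span_singleton_eq_bot]
    exact hpow
  obtain rfl : s = 1 := by
    rw [← Fintype.card_fin s, ← Module.finrank_eq_card_basis P, h, finrank_span_singleton hpow]
  obtain ⟨κ, hκ⟩ : ∃ κ : F, κ • tensorPow d x = (P 0 : Tensor F n d) :=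
    Submodule.mem_span_singleton.1 (h ▸ (P 0).2)
  have hκ0 : κ ≠ 0 := by
    rintro rfl
    rw [zero_smul] at hκ
    exact P.ne_zero 0 (Subtype.ext hκ.symm)
  cases ho with
  | trivial h' => exact absurd h' hbot
  | fail_size _ hs => omega
  | only _ _ o _ c y hy =>
    obtain ⟨-, hli, hP, -⟩ := hy
    have hy0 : y 0 ≠ 0 := hli.ne_zero 0
    have hP0 : (P 0 : Tensor F n d) = _ := hP 0
    rw [Fin.sum_univ_one, ← hκ] at hP0
    have hc0 : c 0 0 ≠ 0 := by
      intro h0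
      rw [h0, zero_smul] at hP0
      exact smul_ne_zero hκ0 hpow hP0
    obtain ⟨t, ht, hyt⟩ := eq_smul_of_tensorPow_eq_smul hd (x := x) hy0
      (q := (c 0 0)⁻¹ * κ) (by rw [mul_smul, hP0, inv_smul_smul₀ hc0])
    exact ⟨t, ht, 0, hyt⟩
  | fail_decomposition _ _ o ho' hno =>
    exfalso
    set z : (Fin (d - 1) → Fin n) → F := tensorPow (d - 1) x
    have hcontract : ∀ ξ : Fin 1 → F, contract (sliceTensor fun i => (P i : Tensor F n d)) ξ
        = (ξ 0 * κ) • Matrix.vecMulVec x z := fun ξ => by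
      ext a b
      simp only [contract, Fin.sum_univ_one, sliceTensor, ← hκ, Matrix.smul_apply,
        Matrix.of_apply, Pi.smul_apply, smul_eq_mul, tensorPow_consIndex hd,
        Matrix.vecMulVec_apply]
      ring
    have hne : ∀ ξ : Fin 1 → F, ξ ≠ 0 → ξ 0 * κ ≠ 0 := fun ξ hξ => by
      refine mul_ne_zero (fun h0 => hξ (funext fun i => ?_)) hκ0
      rw [Subsingleton.elim i 0, h0]
      rfl
    obtain ⟨α, β, g, hα, hβ, hg, rfl⟩ := ho'.of_contract_eq_smul (hcontract η) (hcontract θ)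
      (hne η hη) (hne θ hθ) hx fun h0 => hx (tensorPow_eq_zero h0)
    -- The scalings of the two eigenvectors are compensated by the dual functional, so the output is
    -- a valid power decomposition whatever choices were made.
    have hw : α * β * contractPair (sliceTensor fun i => (P i : Tensor F n d)) g 0 = κ := by
      calc _ = κ * ∑ b, ∑ c, g b c * ((α * x b) * (β * z c)) := by
            simp only [contractPair, sliceTensor, ← hκ, Matrix.of_apply, Pi.smul_apply,
              smul_eq_mul, tensorPow_consIndex hd, Finset.mul_sum]
            refine Finset.sum_congr rfl fun b _ => Finset.sum_congr rfl fun c _ => ?_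
            ring
        _ = κ := by rw [hg, mul_one]
    refine hno ⟨fun _ _ => κ, fun _ => x, ?_, ?_, ?_, _, _, _, rfl, ?_⟩
    · exact LinearIndependent.of_subsingleton 0 fun h0 => hκ0 (congrFun h0 0)
    · exact LinearIndependent.of_subsingleton 0 hx
    · intro q
      rw [Subsingleton.elim q 0, Fin.sum_univ_one, hκ]
    · intro i q a b
      rw [Subsingleton.elim q 0, tensorPow_consIndex hd, ← hw]
      simp only [Pi.smul_apply, smul_eq_mul]
      ring

end Intersect

/-! ### The random functionals are almost surely non-zero -/

section Sphere

open MeasureTheory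

instance isFiniteMeasure_uniformSphere (s : ℕ) : IsFiniteMeasure (uniformSphere F s) := by
  unfold uniformSphere
  dsimp only
  split_ifs
  · infer_instance
  · refine ⟨?_⟩
    rw [Measure.smul_apply, Measure.map_apply measurable_subtype_coe MeasurableSet.univ,
      Set.preimage_univ, smul_eq_mul]
    exact (ENNReal.inv_mul_le_one _).trans_lt ENNReal.one_lt_top

theorem ae_uniformSphere_ne_zero {s : ℕ} (hs : s ≠ 0) : ∀ᵐ η ∂(uniformSphere F s), η ≠ 0 := by
  unfold uniformSphere
  dsimp only
  rw [if_neg hs]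
  refine Measure.ae_smul_measure ?_ _
  refine (ae_map_iff measurable_subtype_coe.aemeasurable
    (MeasurableSet.singleton _).compl).2 (Filter.Eventually.of_forall fun η => ?_)
  exact ne_zero_of_mem_unit_sphere η

end Sphere

/-! ### The componentwise algorithm -/

section Components

open MeasureTheory

variable {n k R : ℕ}

theorem liftedIntersection_congr {p d : ℕ} {u v : Fin R → Fin n → F}
    (h : Submodule.span F (Set.range u) = Submodule.span F (Set.range v))
    (f : Fin p → MvPolynomial (Fin n) F) :
    liftedIntersection d u f = liftedIntersection d v f := by
  rw [liftedIntersection, liftedIntersection, h]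

theorem exists_componentsRun (d : Fin k → ℕ) (u : Fin R → Fin n → F) {p : Fin k → ℕ}
    (f : ∀ i, Fin (p i) → MvPolynomial (Fin n) F)
    (P : ∀ i, Module.Basis (Fin (liftedDim (d i) u (f i))) F (liftedIntersection (d i) u (f i)))
    (ω : ∀ i, EuclideanSpace F (Fin (liftedDim (d i) u (f i))) ×
      EuclideanSpace F (Fin (liftedDim (d i) u (f i)))) :
    ∃ o, ComponentsRun d u f P ω o := by
  choose o ho using fun i => exists_intersectRun (d i) u (f i) (P i) (ω i).1 (ω i).2
  exact ⟨_, o, ho, rfl⟩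

theorem componentsAlgorithmOutputs_trivial {d : Fin k → ℕ} {u : Fin R → Fin n → F}
    {p : Fin k → ℕ} {f : ∀ i, Fin (p i) → MvPolynomial (Fin n) F}
    (h : ∀ i, liftedIntersection (d i) u (f i) = ⊥) :
    ComponentsAlgorithmOutputs d u f fun o => o = .trivial := by
  refine fun P => Filter.Eventually.of_forall fun ω => ⟨exists_componentsRun d u f P ω, ?_⟩
  rintro _ ⟨o, ho, rfl⟩
  have htriv : ∀ i, o i = .trivial := fun i => (ho i).eq_trivial (h i)
  have hempty : ¬ {x | x ≠ 0 ∧ ∃ i, x ∈ (o i).reported}.Nonempty := by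
    rintro ⟨x, -, i, hi⟩
    rw [htriv i] at hi
    exact hi
  rw [combineOutputs, if_neg hempty, if_pos htriv]

theorem componentsAlgorithmOutputs_found {d : Fin k → ℕ} {u : Fin R → Fin n → F}
    {p : Fin k → ℕ} {f : ∀ i, Fin (p i) → MvPolynomial (Fin n) F} (hR : 0 < R) (i : Fin k)
    (hd : 0 < d i) {x : Fin n → F} (hx : x ≠ 0)
    (h : liftedIntersection (d i) u (f i) = Submodule.span F {tensorPow (d i) x}) :
    ComponentsAlgorithmOutputs d u f fun o => ∃ S, o = .found S ∧ ∃ c : F, c ≠ 0 ∧ c • x ∈ S := by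
  intro P
  have hdim : liftedDim (d i) u (f i) ≠ 0 := by
    have : liftedDim (d i) u (f i) = 1 := by
      unfold liftedDim
      rw [h, finrank_span_singleton fun h0 => hx (tensorPow_eq_zero h0)]
    rw [this]
    exact one_ne_zero
  have hae : ∀ᵐ ω ∂((uniformSphere F (liftedDim (d i) u (f i))).prod
      (uniformSphere F (liftedDim (d i) u (f i)))), ω.1 ≠ 0 ∧ ω.2 ≠ 0 :=
    (Measure.quasiMeasurePreserving_fst.ae (ae_uniformSphere_ne_zero hdim)).and
      (Measure.quasiMeasurePreserving_snd.ae (ae_uniformSphere_ne_zero hdim))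
  -- Only the draws for component i matter: whatever the other runs return, the combined output
  -- contains the vector found here.
  filter_upwards [(Measure.quasiMeasurePreserving_eval (fun i =>
    (uniformSphere F (liftedDim (d i) u (f i))).prod
      (uniformSphere F (liftedDim (d i) u (f i)))) i).ae hae] with ω hω
  refine ⟨exists_componentsRun d u f P ω, ?_⟩
  rintro _ ⟨o, ho, rfl⟩
  obtain ⟨c, hc, hcx⟩ := (ho i).exists_smul_mem_reported hd hR
    (fun h0 => hω.1 (PiLp.ext fun q => congrFun h0 q))
    (fun h0 => hω.2 (PiLp.ext fun q => congrFun h0 q)) hx h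
  have hmem : c • x ∈ {x | x ≠ 0 ∧ ∃ i, x ∈ (o i).reported} := ⟨smul_ne_zero hc hx, i, hcx⟩
  exact ⟨_, by rw [combineOutputs, if_pos ⟨_, hmem⟩], c, hc, hmem⟩

end Components

end Algorithm

/-! ### Generic tuples -/

section Generic

/-- With N = binom(n+d-2, d-1), the identity (n+d-1) N = d · binom(n+d-1, d) turns the bound on R =
r + 1 into R N (d-1)! ≤ p. The factor (d-1)! is discarded, and N > 0 makes the inequality for r
strict. -/
theorem mul_choose_lt_of_le_div {n d r p : ℕ} (hn : 0 < n) (hd : 0 < d) {δ : ℝ}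
    (hp : (p : ℝ) = δ * ((n + d - 1).choose d : ℝ))
    (hr : ((r + 1 : ℕ) : ℝ) ≤ δ / (d ! : ℝ) * ((n : ℝ) + (d : ℝ) - 1)) :
    r * (n + (d - 1) - 1).choose (d - 1) < p := by
  obtain ⟨m, rfl⟩ := Nat.exists_eq_succ_of_ne_zero hn.ne'
  obtain ⟨e, rfl⟩ := Nat.exists_eq_succ_of_ne_zero hd.ne'
  have h1 : (m + e + 1) * (m + e).choose e = (m + e + 1).choose (e + 1) * (e + 1) :=
    Nat.add_one_mul_choose_eq (m + e) e
  have e1 : m.succ + e.succ - 1 = m + e + 1 := by omega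
  have e2 : m.succ + (e.succ - 1) - 1 = m + e := by omega
  rw [e1] at hp
  rw [e2, Nat.succ_sub_one]
  set N := (m + e).choose e with hN
  have hNpos : 0 < N := Nat.choose_pos (Nat.le_add_left e m)
  have h1' : ((m : ℝ) + e + 1) * N = ((m + e + 1).choose (e + 1) : ℝ) * (e + 1) := by
    exact_mod_cast h1
  have hfac : ((e.succ)! : ℝ) = (e + 1) * (e ! : ℝ) := by
    rw [Nat.succ_eq_add_one, Nat.factorial_succ]
    push_cast
    ring
  have hfac1 : (1 : ℝ) ≤ (e ! : ℝ) := by exact_mod_cast Nat.factorial_pos e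
  have hepos : (0 : ℝ) < e + 1 := by positivity
  have hr' : ((r : ℝ) + 1) * ((e + 1) * (e ! : ℝ)) ≤ δ * ((m : ℝ) + e + 1) := by
    have hpos : (0 : ℝ) < (e + 1) * (e ! : ℝ) := by positivity
    have := mul_le_mul_of_nonneg_right hr hpos.le
    rw [hfac] at this
    calc _ = ((r + 1 : ℕ) : ℝ) * ((e + 1) * (e ! : ℝ)) := by push_cast; ring
      _ ≤ _ := this
      _ = δ * ((m : ℝ) + e + 1) := by
        push_cast
        field_simp
        ring
  have key : ((r : ℝ) + 1) * N ≤ p := by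
    refine le_of_mul_le_mul_right ?_ hepos
    calc ((r : ℝ) + 1) * N * (e + 1) ≤ ((r : ℝ) + 1) * ((e + 1) * (e ! : ℝ)) * N := by
          have : ((r : ℝ) + 1) * N * (e + 1) * 1 ≤ ((r : ℝ) + 1) * N * (e + 1) * (e ! : ℝ) :=
            mul_le_mul_of_nonneg_left hfac1 (by positivity)
          linarith
      _ ≤ δ * ((m : ℝ) + e + 1) * N := mul_le_mul_of_nonneg_right hr' (by positivity)
      _ = p * (e + 1) := by rw [hp, mul_assoc, h1']; ring
  have key' : (r + 1) * N ≤ p := by exact_mod_cast key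
  rw [add_mul, one_mul] at key'
  omega

/-- Use n + d - 1 ≤ nd ≤ n · d!, where the first inequality is (n-1)(d-1) ≥ 0. This leaves room for
R independent vectors. -/
theorem le_of_le_div_factorial {n d R : ℕ} (hn : 0 < n) (hd : 0 < d) {δ : ℝ} (hδ : δ ≤ 1)
    (hR : (R : ℝ) ≤ δ / (d ! : ℝ) * ((n : ℝ) + (d : ℝ) - 1)) : R ≤ n := by
  have hn1 : (1 : ℝ) ≤ n := by exact_mod_cast hn
  have hd1 : (1 : ℝ) ≤ d := by exact_mod_cast hd
  have hfac : (d : ℝ) ≤ (d ! : ℝ) := by exact_mod_cast Nat.self_le_factorial d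
  have hpos : (0 : ℝ) < d ! := by positivity
  have h1 : (R : ℝ) ≤ n := by
    refine hR.trans ?_
    rw [div_mul_eq_mul_div, div_le_iff₀ hpos]
    have h2 : δ * ((n : ℝ) + d - 1) ≤ 1 * ((n : ℝ) + d - 1) :=
      mul_le_mul_of_nonneg_right hδ (by linarith)
    have h3 : 0 ≤ ((n : ℝ) - 1) * (d - 1) := mul_nonneg (by linarith) (by linarith)
    have h4 : (n : ℝ) * d ≤ n * (d ! : ℝ) := mul_le_mul_of_nonneg_left hfac (by linarith)
    nlinarith
  exact_mod_cast h1

theorem apply_lt_of_mem_exponents_erase {R d : ℕ} {z : Fin R} {b : Fin R → ℕ}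
    (hb : b ∈ (exponents R d).erase (pureExponent z d)) : b z < d := by
  obtain ⟨hne, hmem⟩ := Finset.mem_erase.1 hb
  have hsum := mem_exponents.1 hmem
  rw [← Finset.add_sum_erase _ _ (Finset.mem_univ z)] at hsum
  refine lt_of_le_of_ne (by omega) fun h => hne (funext fun i => ?_)
  by_cases hi : i = z
  · subst hi
    simp [pureExponent, h]
  · have h0 : ∑ i ∈ Finset.univ.erase z, b i = 0 := by omega
    rw [Finset.sum_eq_zero_iff.1 h0 i (Finset.mem_erase.2 ⟨hi, Finset.mem_univ i⟩)]
    simp [pureExponent, hi]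

section Field

variable {F : Type*} [Field F] {n : ℕ}

theorem PolyIrreducible.exists_tuple_forall_ne_zero [Infinite F] {R : ℕ} {ι : Type*}
    {Y : Set (Fin n → F)} (hY : PolyIrreducible Y) (hne : Y.Nonempty) (z : Fin R) (s : Finset ι)
    {H : ι → (Fin R → Fin n → F) → F} (hH : ∀ i ∈ s, H i ∈ tuplePolyFun R n F)
    (h : ∀ i ∈ s, ∃ v, v z ∈ Y ∧ H i v ≠ 0) : ∃ v, v z ∈ Y ∧ ∀ i ∈ s, H i v ≠ 0 := by
  classical
  suffices h : ∃ v : Fin R → Fin n → F, v z ∈ Y ∧ ∏ i ∈ s, H i v ≠ 0 by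
    simpa [Finset.prod_ne_zero_iff] using h
  induction s using Finset.induction_on with
  | empty => simpa using ⟨fun _ => hne.some, hne.some_mem⟩
  | insert i s hi ih =>
    simp only [Finset.prod_insert hi]
    obtain ⟨v, hv, h1, h2⟩ := hY.exists_tuple_ne_zero z (hH i (Finset.mem_insert_self _ _))
      (prod_mem_tuplePolyFun s fun j hj => hH j (Finset.mem_insert_of_mem hj))
      (h i (Finset.mem_insert_self _ _))
      (ih (fun j hj => hH j (Finset.mem_insert_of_mem hj))
        fun j hj => h j (Finset.mem_insert_of_mem hj))
    exact ⟨v, hv, mul_ne_zero h1 h2⟩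

/-- A form of lower degree that vanishes on Y can be multiplied by a power of a coordinate to reach
degree m. -/
theorem IsNondegenerateOfOrder.exists_eval_ne_zero {m e : ℕ} (hn : 0 < n) {Y : Set (Fin n → F)}
    (hY : IsNondegenerateOfOrder m Y) (he : e ≤ m) {g : MvPolynomial (Fin n) F}
    (hg : g.IsHomogeneous e) (h0 : g ≠ 0) : ∃ x ∈ Y, MvPolynomial.eval x g ≠ 0 := by
  by_contra! hcon
  have h := hY (g * MvPolynomial.X ⟨0, hn⟩ ^ (m - e))
    (by simpa [Nat.add_sub_cancel' he] using
      hg.mul ((MvPolynomial.isHomogeneous_X F (⟨0, hn⟩ : Fin n)).pow (m - e)))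
    fun x hx => by rw [map_mul, hcon x hx, zero_mul]
  rcases mul_eq_zero.1 h with h | h
  · exact h0 h
  · exact MvPolynomial.X_ne_zero _ (eq_zero_of_pow_eq_zero h)

/-- For d > 1 a power of a coordinate vanishes at 0 but not on all of the variety. For d = 1
non-degeneracy has order 0 and says nothing about non-zero points; there, fewer than n linear
equations have a non-trivial solution. -/
theorem exists_mem_polyZeroSet_ne_zero {d p : ℕ} (hn : 0 < n) (hd : 0 < d)
    {f : Fin p → MvPolynomial (Fin n) F} (hf : ∀ j, (f j).IsHomogeneous d) (hp : d = 1 → p < n)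
    (hnd : IsNondegenerateOfOrder (d - 1) (polyZeroSet (Set.range f))) :
    ∃ x ∈ polyZeroSet (Set.range f), x ≠ 0 := by
  by_cases h1 : d = 1
  · subst h1
    set L : (Fin n → F) →ₗ[F] Fin p → F := LinearMap.pi fun j =>
      MvPolynomial.lcoeff F 0 ∘ₗ LinearMap.applyₗ (f j) ∘ₗ dirDeriv
    obtain ⟨x, hx, hx0⟩ := Submodule.exists_mem_ne_zero_of_ne_bot
      (LinearMap.ker_ne_bot_of_finrank_lt (f := L) (by simpa using hp rfl))
    refine ⟨x, ?_, hx0⟩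
    rintro _ ⟨j, rfl⟩
    have h2 := (hf j).coeff_zero_dirDeriv_pow x
    rw [pow_one, Nat.factorial_one, Nat.cast_one, one_mul] at h2
    rw [← h2]
    exact congrFun hx j
  · by_contra! hcon
    have hX := (MvPolynomial.isHomogeneous_X F (⟨0, hn⟩ : Fin n)).pow (d - 1)
    rw [one_mul] at hX
    obtain ⟨x, hx, hne⟩ := hnd.exists_eval_ne_zero hn le_rfl hX
      (pow_ne_zero _ (MvPolynomial.X_ne_zero _))
    rw [hcon x hx] at hne
    refine hne ?_
    rw [map_pow, MvPolynomial.eval_X, Pi.zero_apply, zero_pow (by omega)]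

end Field

variable {F : Type*} [RCLike F] {n : ℕ}

/-- The general linear group is transitive on non-zero vectors, so part of the standard basis can be
moved to have x at place z. -/
theorem exists_linearIndependent_apply_eq {R : ℕ} (hR : R ≤ n) (z : Fin R) {x : Fin n → F}
    (hx : x ≠ 0) : ∃ v : Fin R → Fin n → F, LinearIndependent F v ∧ v z = x := by
  have hli : LinearIndependent F fun q : Fin R => Pi.basisFun F (Fin n) (Fin.castLE hR q) :=
    (Pi.basisFun F (Fin n)).linearIndependent.comp _ (Fin.castLE_injective hR)
  obtain ⟨A, hA⟩ := SeparatingDual.exists_continuousLinearEquiv_apply_eq (R := F)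
    (hli.ne_zero z) hx
  exact ⟨_, hli.map' A.toLinearMap (LinearMap.ker_eq_bot.2 A.injective), hA⟩

end Generic

theorem theorem5p1 {F : Type*} [RCLike F] (n k : ℕ) (hn : 0 < n) (hk : 0 < k)
    (d : Fin k → ℕ) (hd : ∀ i, 0 < d i)
    (δ : Fin k → ℝ) (hδ : ∀ i, 0 < δ i ∧ δ i < 1)
    (X : Set (Fin n → F)) (hX : IsClosed[zariskiTopology (Fin n) F] X) (hconic : IsConic X)
    (C : Fin k → Set (Fin n → F)) (hC : IsIrreducibleComponents X C)
    (hnondeg : ∀ i, IsNondegenerateOfOrder (d i - 1) (C i))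
    (p : Fin k → ℕ) (hp : ∀ i, (p i : ℝ) = δ i * ((n + d i - 1).choose (d i) : ℝ))
    (f : ∀ i, Fin (p i) → MvPolynomial (Fin n) F)
    (hhom : ∀ i j, (f i j).IsHomogeneous (d i))
    (hindep : ∀ i, LinearIndependent F (f i))
    (hcut : ∀ i, C i = polyZeroSet (Set.range (f i)))
    (R : ℕ) (hR : 0 < R)
    (hRle : ∀ i, (R : ℝ) ≤ δ i / ((d i)! : ℝ) * ((n : ℝ) + (d i : ℝ) - 1)) :
    (∃ A : Set (Fin R → Fin n → F), IsZariskiOpenDenseIn A Set.univ ∧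
      ∀ v ∈ A, LinearIndependent F v ∧
        (Submodule.span F (Set.range v) : Set (Fin n → F)) ∩ X = {0} ∧
        ∀ u : Fin R → Fin n → F, LinearIndependent F u →
          Submodule.span F (Set.range u) = Submodule.span F (Set.range v) →
          ComponentsAlgorithmOutputs d u f (fun o => o = .trivial)) ∧
    (∃ B : Set (Fin R → Fin n → F), IsZariskiOpenDenseIn B {v | v ⟨0, hR⟩ ∈ X} ∧
      ∀ v ∈ B, LinearIndependent F v ∧
        ∀ u : Fin R → Fin n → F, LinearIndependent F u →
          Submodule.span F (Set.range u) = Submodule.span F (Set.range v) →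
          ComponentsAlgorithmOutputs d u f
            (fun o => ∃ S, o = .found S ∧ ∃ c : F, c ≠ 0 ∧ c • v ⟨0, hR⟩ ∈ S)) := by
  obtain ⟨r, rfl⟩ := Nat.exists_eq_succ_of_ne_zero hR.ne'
  have hdim : ∀ i, r * (n + (d i - 1) - 1).choose (d i - 1) < p i := fun i =>
    mul_choose_lt_of_le_div hn (hd i) (hp i) (hRle i)
  have hRn : r + 1 ≤ n :=
    le_of_le_div_factorial hn (hd ⟨0, hk⟩) (hδ ⟨0, hk⟩).2.le (hRle ⟨0, hk⟩)
  have hpn : ∀ i, d i = 1 → p i < n := fun i h1 => by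
    have h := hp i
    rw [h1, Nat.add_sub_cancel, Nat.choose_one_right] at h
    have hn' : (0 : ℝ) < n := by exact_mod_cast hn
    have : (p i : ℝ) < n := by
      rw [h]
      exact mul_lt_of_lt_one_left hn' (hδ i).2
    exact_mod_cast this
  have hCX : ∀ i, C i ⊆ X := fun i => hC.iUnion_eq ▸ Set.subset_iUnion C i
  have hXC : ∀ x ∈ X, ∃ i, x ∈ C i := fun x hx => by
    rw [← hC.iUnion_eq] at hx
    exact Set.mem_iUnion.1 hx
  have hirr : ∀ i, PolyIrreducible (C i) := fun i => .of_isIrreducible (hC.isIrreducible i)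
  constructor
  · have hsep : ∀ i, ∃ v, SeparatesExponents (f i) (exponents (r + 1) (d i)) v := fun i => by
      obtain ⟨v, -, hv⟩ := exists_separatesExponents (hhom i) (hindep i) (hdim i)
        polyIrreducible_univ Set.univ_nonempty (S := exponents (r + 1) (d i))
        (fun b hb => mem_exponents.1 hb) fun b _ g _ hg0 => by
          by_contra! hcon
          exact hg0 (MvPolynomial.funext fun x => by simpa using hcon x trivial)
      exact ⟨v, hv⟩
    choose v₀ hv₀ using hsep
    choose H hH hHv hHsep using fun i => exists_tuplePolyFun_separatesExponents (hv₀ i)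
    obtain ⟨v₁, hv₁, -⟩ := exists_linearIndependent_apply_eq (F := F) hRn 0
      (x := fun _ => 1) (fun h => one_ne_zero (congrFun h ⟨0, hn⟩))
    obtain ⟨G, hG, hGv, hGli⟩ := exists_tuplePolyFun_linearIndependent hv₁
    have hprod := prod_mem_tuplePolyFun Finset.univ fun i _ => hH i
    refine ⟨_, isZariskiOpenDenseIn_of_tuplePolyFun
      (fun (_ : Unit) v => G v * ∏ i, H i v) (fun _ => mul_mem hG hprod) Set.univ ?_, ?_⟩
    · rintro Ψ hΨ ⟨w, -, hw⟩
      obtain ⟨w₁, -, hw₁⟩ := polyIrreducible_univ.exists_tuple_forall_ne_zero Set.univ_nonempty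
        (0 : Fin (r + 1)) Finset.univ (fun i _ => hH i) fun i _ => ⟨v₀ i, trivial, hHv i⟩
      obtain ⟨w₂, -, hw₂⟩ := polyIrreducible_univ.exists_tuple_ne_zero (0 : Fin (r + 1)) hG hprod
        ⟨v₁, trivial, hGv⟩ ⟨w₁, trivial, Finset.prod_ne_zero_iff.2 hw₁⟩
      obtain ⟨w₃, -, hw₃, hw₄⟩ := polyIrreducible_univ.exists_tuple_ne_zero (0 : Fin (r + 1)) hΨ
        (mul_mem hG hprod) ⟨w, trivial, hw⟩ ⟨w₂, trivial, mul_ne_zero hw₂.1 hw₂.2⟩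
      exact ⟨w₃, trivial, hw₃, (), hw₄⟩
    · rintro v ⟨⟨-, hv⟩, -⟩
      have hbot : ∀ i, liftedIntersection (d i) v (f i) = ⊥ := fun i =>
        liftedIntersection_eq_bot (hHsep i v
          (Finset.prod_ne_zero_iff.1 (right_ne_zero_of_mul hv) i (Finset.mem_univ i)))
      refine ⟨hGli v (left_ne_zero_of_mul hv), ?_, fun u _ huv =>
        componentsAlgorithmOutputs_trivial fun i =>
          (liftedIntersection_congr huv (f i)).trans (hbot i)⟩
      refine Set.eq_singleton_iff_unique_mem.2 ⟨⟨Submodule.zero_mem _, ?_⟩, ?_⟩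
      · obtain ⟨x, hx⟩ := (hC.isIrreducible ⟨0, hk⟩).1
        have := hconic 0 x (hCX _ hx)
        rwa [zero_smul] at this
      · rintro x ⟨hxU, hxX⟩
        obtain ⟨i, hxi⟩ := hXC x hxX
        rw [hcut i] at hxi
        -- A point of U on the component would put its tensor power into the lifted intersection,
        -- which is zero.
        have hmem : tensorPow (d i) x ∈ liftedIntersection (d i) v (f i) :=
          ⟨tensorPow_mem_symPower hxU, mem_formsPerp_iff.2 fun j => by
            rw [sum_polyTensor_mul_tensorPow (hhom i j)]
            exact hxi _ ⟨j, rfl⟩⟩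
        rw [hbot i, Submodule.mem_bot] at hmem
        exact tensorPow_eq_zero hmem
  · have hgood : ∀ i, ∃ H ∈ tuplePolyFun (r + 1) n F, (∃ v, v 0 ∈ C i ∧ H v ≠ 0) ∧
        ∀ v, H v ≠ 0 → LinearIndependent F v ∧ (∀ j ≠ i, v 0 ∉ C j) ∧
          SeparatesExponents (f i) ((exponents (r + 1) (d i)).erase (pureExponent 0 (d i))) v := by
      intro i
      have hne : (C i).Nonempty := (hC.isIrreducible i).1
      -- Without the pure exponent all degrees `b 0` are at most d_i - 1, the range covered by
      -- non-degeneracy.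
      obtain ⟨v₀, hv₀C, hv₀⟩ := exists_separatesExponents (hhom i) (hindep i) (hdim i) (hirr i) hne
        (S := (exponents (r + 1) (d i)).erase (pureExponent 0 (d i)))
        (fun b hb => mem_exponents.1 (Finset.mem_of_mem_erase hb)) fun b hb g hg hg0 =>
          (hnondeg i).exists_eval_ne_zero hn
            (Nat.le_sub_one_of_lt (apply_lt_of_mem_exponents_erase hb)) hg hg0
      obtain ⟨H, hH, hHv, hHsep⟩ := exists_tuplePolyFun_separatesExponents hv₀
      obtain ⟨x, hxC, hx0⟩ := exists_mem_polyZeroSet_ne_zero hn (hd i) (hhom i) (hpn i)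
        (hcut i ▸ hnondeg i)
      obtain ⟨v₁, hv₁, hv₁x⟩ := exists_linearIndependent_apply_eq hRn 0 hx0
      obtain ⟨G, hG, hGv, hGli⟩ := exists_tuplePolyFun_linearIndependent hv₁
      -- By irredundancy some polynomial vanishes on the j-th component but not on the i-th. If all
      -- of these are non-zero at v_1, then v_1 lies on no component other than the i-th.
      have hK : ∀ j, ∃ g : MvPolynomial (Fin n) F, j ≠ i →
          (∀ y ∈ C j, MvPolynomial.eval y g = 0) ∧ ∃ y ∈ C i, MvPolynomial.eval y g ≠ 0 := by
        intro j
        by_cases hj : j = i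
        · exact ⟨0, fun h => absurd hj h⟩
        obtain ⟨y, hyi, hyj⟩ := Set.not_subset.1 (hC.irredundant i j (Ne.symm hj))
        obtain ⟨g, hg, hgy⟩ := exists_eval_ne_zero_of_notMem (hC.isClosed j) hyj
        exact ⟨g, fun _ => ⟨hg, y, hyi, hgy⟩⟩
      choose K hK using hK
      obtain ⟨y, hyC, hy⟩ := (hirr i).exists_forall_ne_zero hne (Finset.univ.erase i) K
        fun j hj => (hK j (Finset.ne_of_mem_erase hj)).2
      have hKmem : (fun v : Fin (r + 1) → Fin n → F =>
          ∏ j ∈ Finset.univ.erase i, MvPolynomial.eval (v 0) (K j)) ∈ tuplePolyFun (r + 1) n F :=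
        prod_mem_tuplePolyFun _ fun j _ => eval_comp_mem_tuplePolyFun (K j) 0
      obtain ⟨w₁, hw₁C, hw₁⟩ := (hirr i).exists_tuple_ne_zero 0 hG hKmem
        ⟨v₁, by rw [hv₁x, hcut i]; exact hxC, hGv⟩
        ⟨fun _ => y, hyC, Finset.prod_ne_zero_iff.2 hy⟩
      obtain ⟨w₂, hw₂C, hw₂⟩ := (hirr i).exists_tuple_ne_zero 0 hH (mul_mem hG hKmem)
        ⟨v₀, hv₀C, hHv⟩ ⟨w₁, hw₁C, mul_ne_zero hw₁.1 hw₁.2⟩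
      refine ⟨_, mul_mem hH (mul_mem hG hKmem), ⟨w₂, hw₂C, mul_ne_zero hw₂.1 hw₂.2⟩,
        fun v hv => ?_⟩
      have h1 := right_ne_zero_of_mul hv
      refine ⟨hGli v (left_ne_zero_of_mul h1), fun j hj hvj => ?_,
        hHsep v (left_ne_zero_of_mul hv)⟩
      exact Finset.prod_ne_zero_iff.1 (right_ne_zero_of_mul h1) j
        (Finset.mem_erase.2 ⟨hj, Finset.mem_univ j⟩) ((hK j hj).1 _ hvj)
    choose H hH hHne hHgood using hgood
    refine ⟨_, isZariskiOpenDenseIn_of_tuplePolyFun H hH {v | v 0 ∈ X} ?_, ?_⟩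
    -- Density is checked on the component that contains the first entry of the given tuple, where
    -- irreducibility applies.
    · rintro Ψ hΨ ⟨w, hwX, hw⟩
      obtain ⟨i, hwi⟩ := hXC _ hwX
      obtain ⟨v, hvC, h1, h2⟩ := (hirr i).exists_tuple_ne_zero 0 hΨ (hH i) ⟨w, hwi, hw⟩ (hHne i)
      exact ⟨v, hCX i hvC, h1, i, h2⟩
    · rintro v ⟨⟨i, hv⟩, hvX⟩
      obtain ⟨hli, hnot, hsep⟩ := hHgood i v hv
      obtain ⟨j, hvj⟩ := hXC _ hvX
      have hvi : v 0 ∈ C i := by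
        by_cases hj : j = i
        · exact hj ▸ hvj
        · exact absurd hvj (hnot j hj)
      refine ⟨hli, fun u _ huv => ?_⟩
      exact componentsAlgorithmOutputs_found hR i (hd i) (hli.ne_zero 0)
        ((liftedIntersection_congr huv (f i)).trans
          (liftedIntersection_eq_span 0 (hhom i) (hcut i ▸ hvi) hsep))
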